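/- Let $d\ge 1$. Embed $\mathbb R^d$ in the real projective space $\mathbb P\mathbb R^d=(\mathbb R^{d+1}\setminus\{0\})/\mathbb R^*$ by $x\mapsto(1:x_1:\dots:x_d)$. A projective map is a map of $\mathbb P\mathbb R^d$ induced by an invertible linear map of $\mathbb R^{d+1}$; a projective map that sends a set $D\subset\mathbb R^d$ into $\mathbb R^d$ is identified with its restriction to $D$. A projective automorphism of $D$ is a projective map that sends $D$ bijectively onto itself, and two subsets of $\mathbb R^d$ are projectively equivalent if some projective map sends one onto the other. A point $p\in\partial D$ of an open set $D\subset\mathbb R^d$ is called strictly convex if $\partial D$ is $\mathcal C^2$-smooth near $p$, i.e. there are an open neighbourhood $U$ of $p$ and a $\mathcal C^2$ function $r:U\to\mathbb R$ with $D\cap U=\{r<0\}$, $\partial D\cap U=\{r=0\}$ and $dr\ne0$ on $\partial D\cap U$, and if the Hessian of $r$ at $p$ is positive definite on the tangent hyperplane $\ker dr(p)$. Theorem. Let $D\subset\mathbb R^d$ be a domain (a non-empty connected open set). Assume that there exist points $p\in\partial D$, $q\in D$ and a sequence $(\varphi_j)$ of projective automorphisms of $D$ such that $\varphi_j(q)\to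 p$. If $p$ is strictly convex, then $D$ is projectively equivalent to the unit ball of $\mathbb R^d$. -/

import Mathlib

open Filter Topology
open scoped LinearAlgebra.Projectivization

/-- Homogeneous coordinates `(1, x_1, …, x_d)` of a point of `ℝ^d`. -/
def homog {d : ℕ} (x : EuclideanSpace ℝ (Fin d)) : Fin (d + 1) → ℝ :=
  Fin.cons 1 (fun i => x i)

theorem homog_ne_zero {d : ℕ} (x : EuclideanSpace ℝ (Fin d)) : homog x ≠ 0 := by
  intro h
  have h0 := congrFun h 0
  simp [homog] at h0

/-- The standard embedding `x ↦ (1 : x_1 : … : x_d)` of `ℝ^d` into the projective space `ℙℝ^d`. -/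
noncomputable def affineEmb {d : ℕ} (x : EuclideanSpace ℝ (Fin d)) : ℙ ℝ (Fin (d + 1) → ℝ) :=
  Projectivization.mk ℝ (homog x) (homog_ne_zero x)

/-- A projective map of `ℙℝ^d`: a map induced by a linear map of `ℝ^(d+1)` (which has to be
injective, hence invertible, in order to induce a map on the whole projective space). -/
def IsProjectiveMap {d : ℕ} (Φ : ℙ ℝ (Fin (d + 1) → ℝ) → ℙ ℝ (Fin (d + 1) → ℝ)) : Prop :=
  ∃ (L : (Fin (d + 1) → ℝ) →ₗ[ℝ] (Fin (d + 1) → ℝ)) (hL : Function.Injective L),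
    Φ = Projectivization.map L hL

/-- `f` is, on the set `D ⊆ ℝ^d`, the restriction of a projective map of `ℙℝ^d`
(which in particular sends no point of `D` to infinity). -/
def IsProjectiveOn {d : ℕ} (f : EuclideanSpace ℝ (Fin d) → EuclideanSpace ℝ (Fin d))
    (D : Set (EuclideanSpace ℝ (Fin d))) : Prop :=
  ∃ Φ : ℙ ℝ (Fin (d + 1) → ℝ) → ℙ ℝ (Fin (d + 1) → ℝ),
    IsProjectiveMap Φ ∧ ∀ x ∈ D, affineEmb (f x) = Φ (affineEmb x)

/-- `f` restricts to a projective automorphism of `D`. -/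
def IsProjectiveAut {d : ℕ} (f : EuclideanSpace ℝ (Fin d) → EuclideanSpace ℝ (Fin d))
    (D : Set (EuclideanSpace ℝ (Fin d))) : Prop :=
  IsProjectiveOn f D ∧ Set.BijOn f D D

/-- `D` and `D'` are projectively equivalent: a projective map sends `D` onto `D'`. -/
def ProjectivelyEquivalent {d : ℕ} (D D' : Set (EuclideanSpace ℝ (Fin d))) : Prop :=
  ∃ f : EuclideanSpace ℝ (Fin d) → EuclideanSpace ℝ (Fin d),
    IsProjectiveOn f D ∧ Set.BijOn f D D'

/-- `r` is a `C^2` defining function of `D` on the open set `U`. -/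
structure IsC2DefiningFunction {d : ℕ} (D U : Set (EuclideanSpace ℝ (Fin d)))
    (r : EuclideanSpace ℝ (Fin d) → ℝ) : Prop where
  contDiffOn : ContDiffOn ℝ 2 r U
  inter_eq : D ∩ U = {x ∈ U | r x < 0}
  frontier_inter_eq : frontier D ∩ U = {x ∈ U | r x = 0}
  fderiv_ne_zero : ∀ x ∈ frontier D ∩ U, fderiv ℝ r x ≠ 0

/-- `p` is a strictly convex boundary point of `D`: near `p` the boundary is `C^2`-smooth, and the
Hessian at `p` of the defining function is positive definite on the tangent hyperplane at `p`. -/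
def IsStrictlyConvexPoint {d : ℕ} (D : Set (EuclideanSpace ℝ (Fin d)))
    (p : EuclideanSpace ℝ (Fin d)) : Prop :=
  p ∈ frontier D ∧
    ∃ (U : Set (EuclideanSpace ℝ (Fin d))) (r : EuclideanSpace ℝ (Fin d) → ℝ),
      IsOpen U ∧ p ∈ U ∧ IsC2DefiningFunction D U r ∧
        ∀ v : EuclideanSpace ℝ (Fin d), v ≠ 0 → fderiv ℝ r p v = 0 →
          0 < fderiv ℝ (fderiv ℝ r) p v v

/-!
Projective maps of `ℝ^d` are linear maps of `ℝ × ℝ^d`, and a domain `D` is replaced by the cone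
`coneOver D` over `{1} × D`: automorphisms of `D` become linear automorphisms of the cone, and the
unit ball corresponds to the Lorentz cone `‖u‖ < t`. The proof is a scaling argument.

*Local geometry.* In suitable linear coordinates the boundary near the strictly convex point `p` is
pinched between tangent spheres, uniformly in the boundary point
(`IsStrictlyConvexPoint.exists_hasQuadraticContact`). This property, `HasQuadraticContact`, is all
that is used about the smoothness of the boundary.

*Convexity.* A segment in `D` through a point near `p` is short on the side that points outwards,
so invariance of the cross ratio shows that `φ_j x → p` for all `x ∈ D` as soon as this holds for
one point (`HasQuadraticContact.tendsto_dehomog`). Since `D` is convex near `p`, it contains the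
segment between `φ_j x` and `φ_j y` for large `j`, and then the one between `x` and `y`
(`HasQuadraticContact.convex`).

*Scaling.* Let `z ∈ D` be close to `p`, at distance `h` from its nearest boundary point. The
parabolic dilation by `√h` in the tangential and by `h` in the normal direction, followed by a
projective map from a paraboloid to the ball, sends `z` to the centre and `D` to a set between the
balls of radii `1 - η` and `1 + η`; convexity controls the part of `D` far from `p`
(`HasQuadraticContact.exists_sandwich`).

*Limit.* Applied to `z = φ_j q`, this gives linear maps `L_j` that send `(1, q)` to `(1, 0)` and
nearly carry the cone over `D` to the Lorentz cone. As `D` contains a neighbourhood of `q` and its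
cone is proper, `L_j` and its inverse stay bounded, and a limit of a subsequence carries one cone
exactly to the other (`exists_equiv_coneOver_ball_of_sandwich`).
-/

/-! ### Homogeneous coordinates and cones -/

section Cone

variable {E : Type*} [NormedAddCommGroup E] [NormedSpace ℝ E]

/-- The cone in `ℝ × E` over the copy `{1} × D` of a set `D ⊆ E`. -/
def coneOver (D : Set E) : Set (ℝ × E) := {y | 0 < y.1 ∧ y.1⁻¹ • y.2 ∈ D}

/-- The affine point `u / t` represented by the homogeneous coordinates `(t, u)`
(junk value `0` for the points at infinity, where `t = 0`). -/
noncomputable def dehomog (y : ℝ × E) : E := y.1⁻¹ • y.2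

theorem mem_coneOver {D : Set E} {y : ℝ × E} : y ∈ coneOver D ↔ 0 < y.1 ∧ dehomog y ∈ D :=
  Iff.rfl

theorem one_mem_coneOver {D : Set E} {x : E} : ((1 : ℝ), x) ∈ coneOver D ↔ x ∈ D := by
  simp [coneOver]

theorem smul_mem_coneOver {D : Set E} {c : ℝ} (hc : 0 < c) {y : ℝ × E} :
    c • y ∈ coneOver D ↔ y ∈ coneOver D := by
  have h : (c * y.1)⁻¹ • c • y.2 = y.1⁻¹ • y.2 := by
    rw [smul_smul]; congr 1; field_simp
  simp only [coneOver, Set.mem_ofPred_eq, Prod.smul_fst, Prod.smul_snd, smul_eq_mul, h,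
    mul_pos_iff_of_pos_left hc]

theorem eq_smul_dehomog {y : ℝ × E} (h : y.1 ≠ 0) : y = y.1 • ((1 : ℝ), dehomog y) := by
  ext <;> simp [dehomog, smul_smul, h]

theorem dehomog_mk_smul {c : ℝ} (hc : c ≠ 0) (x : E) : dehomog (c, c • x) = x := by
  simp [dehomog, smul_smul, hc]

theorem isOpen_coneOver {D : Set E} (hD : IsOpen D) : IsOpen (coneOver D) := by
  have hU : IsOpen {y : ℝ × E | 0 < y.1} := isOpen_lt continuous_const continuous_fst
  have hf : ContinuousOn (fun y : ℝ × E => y.1⁻¹ • y.2) {y | 0 < y.1} := by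
    refine ContinuousOn.smul (ContinuousOn.inv₀ continuousOn_fst ?_) continuousOn_snd
    intro y hy
    exact ne_of_gt hy
  exact hf.isOpen_inter_preimage hU hD

theorem mem_coneOver_ball {y : ℝ × E} :
    y ∈ coneOver (Metric.ball (0 : E) 1) ↔ ‖y.2‖ < y.1 := by
  simp only [coneOver, Set.mem_ofPred_eq, mem_ball_zero_iff, norm_smul, norm_inv, Real.norm_eq_abs]
  constructor
  · rintro ⟨h, h2⟩
    rwa [abs_of_pos h, inv_mul_lt_iff₀ h, mul_one] at h2
  · intro h
    have h1 : 0 < y.1 := (norm_nonneg _).trans_lt h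
    rw [abs_of_pos h1, inv_mul_lt_iff₀ h1, mul_one]
    exact ⟨h1, h⟩

/-- A linear map preserving the cone over `D` induces a map of `D` that carries segments in `D`
to segments in `D`. -/
theorem segment_dehomog_subset {D : Set E} {Φ : (ℝ × E) →ₗ[ℝ] (ℝ × E)}
    (hΦ : ∀ y ∈ coneOver D, Φ y ∈ coneOver D) {a b : E} (h : segment ℝ a b ⊆ D) :
    segment ℝ (dehomog (Φ (1, a))) (dehomog (Φ (1, b))) ⊆ D := by
  rintro _ ⟨s, t, hs, ht, hst, rfl⟩
  have ha := (mem_coneOver.1 (hΦ _ (one_mem_coneOver.2 (h (left_mem_segment ℝ a b))))).1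
  have hb := (mem_coneOver.1 (hΦ _ (one_mem_coneOver.2 (h (right_mem_segment ℝ a b))))).1
  set ca := (Φ (1, a)).1 with hca
  set cb := (Φ (1, b)).1 with hcb
  set y : ℝ × E := (s / ca) • (1, a) + (t / cb) • (1, b) with hy
  have hpos : 0 < s / ca + t / cb := by
    rcases hs.eq_or_lt with h0 | h0
    · have : t = 1 := by linarith
      rw [← h0, this]; simpa using hb
    · have : 0 < s / ca := by positivity
      have : 0 ≤ t / cb := by positivity
      linarith
  have hy1 : y.1 = s / ca + t / cb := by simp [hy]
  have hyD : y ∈ coneOver D := by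
    refine ⟨by rw [hy1]; exact hpos, h ?_⟩
    refine ⟨(s / ca + t / cb)⁻¹ * (s / ca), (s / ca + t / cb)⁻¹ * (t / cb), by positivity,
      by positivity, ?_, ?_⟩
    · rw [← mul_add, inv_mul_cancel₀ hpos.ne']
    · rw [hy1]; simp [hy, smul_add, smul_smul]
  have hΦy : Φ y = (1, s • dehomog (Φ (1, a)) + t • dehomog (Φ (1, b))) := by
    rw [hy, map_add, map_smul, map_smul, eq_smul_dehomog ha.ne', eq_smul_dehomog hb.ne',
      ← hca, ← hcb, smul_smul, smul_smul, div_mul_cancel₀ _ ha.ne', div_mul_cancel₀ _ hb.ne']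
    ext
    · simp [hst]
    · simp [dehomog_mk_smul ha.ne', dehomog_mk_smul hb.ne']
  have := hΦ y hyD
  rw [hΦy] at this
  exact one_mem_coneOver.1 this

end Cone

/-! ### Quadratic contact and convexity of the domain -/

section Contact

variable {E : Type*} [NormedAddCommGroup E] [NormedSpace ℝ E]

/-- Near `p`, and up to an error `ε ‖x - s‖²` that is uniform in the boundary point `s`, the set `D`
is given by the inequality `ℓ s (x - s) + ‖x - s‖² < 0`, which for a Euclidean norm describes a ball
tangent to `D` at `s`. -/
structure HasQuadraticContact (D : Set E) (p : E) (ℓ : E → E →L[ℝ] ℝ) : Prop where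
  continuousAt : ContinuousAt ℓ p
  ne_zero : ℓ p ≠ 0
  contact : ∀ ε > 0, ∃ δ > 0, ∀ s ∈ frontier D, dist s p < δ → ∀ x, dist x p < δ →
    (x ∈ D → ℓ s (x - s) + (1 - ε) * ‖x - s‖ ^ 2 < 0) ∧
    (ℓ s (x - s) + (1 + ε) * ‖x - s‖ ^ 2 < 0 → x ∈ D)

theorem IsPreconnected.subset_of_disjoint_frontier {X : Type*} [TopologicalSpace X] {s D : Set X}
    (hs : IsPreconnected s) (hD : IsOpen D) (hne : (s ∩ D).Nonempty)
    (h : ∀ x ∈ s, x ∉ frontier D) : s ⊆ D := by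
  refine hs.subset_of_closure_inter_subset hD hne ?_
  rintro x ⟨hx, hxs⟩
  by_contra hxD
  exact h x hxs (by rw [hD.frontier_eq]; exact ⟨hx, hxD⟩)

variable {D : Set E} {p : E} {ℓ : E → E →L[ℝ] ℝ}

/-- `D` is locally convex at `p`: the inequalities at a point where a segment leaves `D` would
contradict each other. -/
theorem HasQuadraticContact.exists_segment_subset (hD : IsOpen D)
    (hC : HasQuadraticContact D p ℓ) :
    ∃ δ > 0, ∀ a ∈ D, ∀ b ∈ D, dist a p < δ → dist b p < δ → segment ℝ a b ⊆ D := by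
  obtain ⟨δ, hδ, h⟩ := hC.contact (1 / 2) (by norm_num)
  refine ⟨δ, hδ, fun a ha b hb hap hbp => ?_⟩
  have hball : segment ℝ a b ⊆ Metric.ball p δ :=
    (convex_ball p δ).segment_subset (by simpa using hap) (by simpa using hbp)
  refine (convex_segment a b).isPreconnected.subset_of_disjoint_frontier hD
    ⟨a, left_mem_segment ℝ a b, ha⟩ ?_
  intro s hs hsf
  have hsp := hball hs
  have h1 := (h s hsf hsp a hap).1 ha
  have h2 := (h s hsf hsp b hbp).1 hb
  obtain ⟨u, v, hu, hv, huv, rfl⟩ := hs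
  have e1 : a - (u • a + v • b) = v • (a - b) := by
    have : u = 1 - v := by linarith
    subst this; module
  have e2 : b - (u • a + v • b) = (-u) • (a - b) := by
    have : v = 1 - u := by linarith
    subst this; module
  rw [e1, map_smul, smul_eq_mul] at h1
  rw [e2, map_smul, smul_eq_mul] at h2
  have n1 : 0 ≤ ‖v • (a - b)‖ ^ 2 := by positivity
  have n2 : 0 ≤ ‖(-u) • (a - b)‖ ^ 2 := by positivity
  have h1' : v * ℓ (u • a + v • b) (a - b) < 0 := by linarith
  have h2' : 0 < u * ℓ (u • a + v • b) (a - b) := by linarith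
  have h3 := pos_of_mul_pos_right h2' hu
  nlinarith [mul_nonneg hv h3.le]

/-- A segment in `D` that starts near `p` and points outwards is short. -/
theorem HasQuadraticContact.norm_lt_of_segment_subset (hC : HasQuadraticContact D p ℓ)
    (hp : p ∈ frontier D) {ε : ℝ} (hε : 0 < ε) :
    ∃ δ > 0, ∀ a m, dist a p < δ → segment ℝ a (a + m) ⊆ D → 0 ≤ ℓ p m → ‖m‖ < ε := by
  obtain ⟨δ₀, hδ₀, h⟩ := hC.contact (1 / 2) (by norm_num)
  have hN : 0 < ‖ℓ p‖ := norm_pos_iff.2 hC.ne_zero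
  set e := min ε (δ₀ / 2) with he
  have he0 : 0 < e := by positivity
  have heδ : e ≤ δ₀ / 2 := min_le_right _ _
  refine ⟨min (e / 2) (e ^ 2 / (8 * ‖ℓ p‖)), by positivity, fun a m hap hseg hm => ?_⟩
  by_contra! hle
  have hap1 : dist a p < e / 2 := hap.trans_le (min_le_left _ _)
  have hap2 : dist a p < e ^ 2 / (8 * ‖ℓ p‖) := hap.trans_le (min_le_right _ _)
  have hem : e ≤ ‖m‖ := (min_le_left _ _).trans hle
  have hm0 : 0 < ‖m‖ := he0.trans_le hem
  set τ := e / ‖m‖ with hτ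
  have hτ0 : 0 < τ := by positivity
  have hτ1 : τ ≤ 1 := (div_le_one hm0).2 hem
  have hxD : a + τ • m ∈ D :=
    hseg ⟨1 - τ, τ, by linarith, hτ0.le, by ring, by module⟩
  have hnorm : ‖τ • m‖ = e := by
    rw [norm_smul, Real.norm_eq_abs, abs_of_pos hτ0, hτ, div_mul_cancel₀ _ hm0.ne']
  have hsub : a + τ • m - p = (a - p) + τ • m := by abel
  rw [dist_eq_norm] at hap1 hap2
  have hub : ‖a + τ • m - p‖ < δ₀ := by
    rw [hsub]; exact (norm_add_le _ _).trans_lt (by linarith)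
  have hlb : e / 2 ≤ ‖a + τ • m - p‖ := by
    rw [hsub]
    have := norm_sub_le_norm_add (τ • m) (a - p)
    rw [add_comm] at this
    linarith
  have h1 := (h p hp (by simpa using hδ₀) _ (by rwa [dist_eq_norm])).1 hxD
  have h2 : ℓ p (a + τ • m - p) = ℓ p (a - p) + τ * ℓ p m := by
    rw [hsub, map_add, map_smul, smul_eq_mul]
  have h3 : -(e ^ 2 / 8) < ℓ p (a - p) := by
    have h4 := (abs_le.1 ((ℓ p).le_opNorm (a - p))).1
    have h5 : ‖ℓ p‖ * ‖a - p‖ < e ^ 2 / 8 := by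
      calc ‖ℓ p‖ * ‖a - p‖ < ‖ℓ p‖ * (e ^ 2 / (8 * ‖ℓ p‖)) := by gcongr
        _ = e ^ 2 / 8 := by field_simp
    linarith
  have h6 : (e / 2) ^ 2 ≤ ‖a + τ • m - p‖ ^ 2 := by gcongr
  have h7 : 0 ≤ τ * ℓ p m := by positivity
  rw [h2] at h1
  nlinarith

/-- Automorphisms of the cone that move the point `a` towards `p` also move `b` towards `p` if the
segment `[a, b]` may be prolonged in `D` by half of its length at both ends: the cross ratio of the
four points bounds the length of the image of `[a, b]` by that of the outward pointing part of
the image of the prolonged segment. -/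
theorem HasQuadraticContact.tendsto_of_segment_subset (hC : HasQuadraticContact D p ℓ)
    (hp : p ∈ frontier D) {Φ : ℕ → (ℝ × E) →ₗ[ℝ] (ℝ × E)}
    (hΦ : ∀ j, ∀ y ∈ coneOver D, Φ j y ∈ coneOver D) {a b : E}
    (hseg : segment ℝ (a - (1 / 2 : ℝ) • (b - a)) (b + (1 / 2 : ℝ) • (b - a)) ⊆ D)
    (ha : Tendsto (fun j => dehomog (Φ j (1, a))) atTop (𝓝 p)) :
    Tendsto (fun j => dehomog (Φ j (1, b))) atTop (𝓝 p) := by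
  set a₀ := a - (1 / 2 : ℝ) • (b - a) with ha₀
  set b₁ := b + (1 / 2 : ℝ) • (b - a) with hb₁
  have hmem₀ : a₀ ∈ segment ℝ a₀ b₁ := left_mem_segment ℝ _ _
  have hmem₁ : b₁ ∈ segment ℝ a₀ b₁ := right_mem_segment ℝ _ _
  have hmema : a ∈ segment ℝ a₀ b₁ :=
    ⟨3 / 4, 1 / 4, by norm_num, by norm_num, by norm_num, by rw [ha₀, hb₁]; module⟩
  have hmemb : b ∈ segment ℝ a₀ b₁ :=
    ⟨1 / 4, 3 / 4, by norm_num, by norm_num, by norm_num, by rw [ha₀, hb₁]; module⟩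
  have hconv := convex_segment (𝕜 := ℝ) a₀ b₁
  rw [Metric.tendsto_nhds] at ha ⊢
  intro ε hε
  obtain ⟨δ, hδ, h⟩ := hC.norm_lt_of_segment_subset hp (ε := ε / 18) (by positivity)
  filter_upwards [ha (min δ (ε / 2)) (by positivity)] with j hj
  have hj1 := hj.trans_le (min_le_left _ _)
  have hj2 := hj.trans_le (min_le_right _ _)
  have hpos : ∀ x ∈ segment ℝ a₀ b₁, 0 < (Φ j (1, x)).1 := fun x hx =>
    (hΦ j _ (one_mem_coneOver.2 (hseg hx))).1
  have ca := hpos a hmema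
  have cb := hpos b hmemb
  have c₀ := hpos a₀ hmem₀
  have c₁ := hpos b₁ hmem₁
  have e₀ : ((1 : ℝ), a₀) = (3 / 2 : ℝ) • (1, a) - (1 / 2 : ℝ) • (1, b) := by
    ext
    · norm_num
    · simp only [ha₀, Prod.snd_sub, Prod.smul_snd]; module
  have e₁ : ((1 : ℝ), b₁) = (3 / 2 : ℝ) • (1, b) - (1 / 2 : ℝ) • (1, a) := by
    ext
    · norm_num
    · simp only [hb₁, Prod.snd_sub, Prod.smul_snd]; module
  have f₀ : Φ j (1, a₀) = (3 / 2 : ℝ) • Φ j (1, a) - (1 / 2 : ℝ) • Φ j (1, b) := by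
    rw [e₀, map_sub, map_smul, map_smul]
  have f₁ : Φ j (1, b₁) = (3 / 2 : ℝ) • Φ j (1, b) - (1 / 2 : ℝ) • Φ j (1, a) := by
    rw [e₁, map_sub, map_smul, map_smul]
  have g₀ := congrArg Prod.fst f₀
  have g₁ := congrArg Prod.fst f₁
  simp only [Prod.fst_sub, Prod.smul_fst, smul_eq_mul] at g₀ g₁
  set A := dehomog (Φ j (1, a)) with hA
  set B := dehomog (Φ j (1, b)) with hB
  set A₀ := dehomog (Φ j (1, a₀)) with hA₀
  set α := (1 / 2) * (Φ j (1, b)).1 / (Φ j (1, a₀)).1 with hα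
  have hαpos : 1 / 9 < α := by
    rw [hα, lt_div_iff₀ c₀]; linarith
  have hline : A₀ = A + (-α) • (B - A) := by
    have k₀ := congrArg Prod.snd f₀
    rw [eq_smul_dehomog ca.ne', eq_smul_dehomog cb.ne', eq_smul_dehomog c₀.ne', ← hA, ← hB,
      ← hA₀] at k₀
    simp only [Prod.snd_sub, Prod.smul_snd] at k₀
    have hcα : α * (Φ j (1, a₀)).1 = 1 / 2 * (Φ j (1, b)).1 := by
      rw [hα, div_mul_cancel₀ _ c₀.ne']
    have : (Φ j (1, a₀)).1 • A₀ = (Φ j (1, a₀)).1 • (A + (-α) • (B - A)) := by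
      rw [k₀]
      have h3 : (3 / 2 : ℝ) * (Φ j (1, a)).1 = (Φ j (1, a₀)).1 + α * (Φ j (1, a₀)).1 := by
        linarith
      rw [smul_smul, smul_smul, h3, ← hcα]
      module
    exact smul_right_injective E c₀.ne' this
  have hAB : ‖B - A‖ < ε / 2 := by
    rcases le_total 0 (ℓ p (B - A)) with hs | hs
    · have := h A (B - A) hj1 (by
        rw [add_sub_cancel]
        exact segment_dehomog_subset (hΦ j) ((hconv.segment_subset hmema hmemb).trans hseg)) hs
      linarith
    · have := h A ((-α) • (B - A)) hj1 (by
        rw [← hline]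
        exact segment_dehomog_subset (hΦ j) ((hconv.segment_subset hmema hmem₀).trans hseg)) (by
        rw [map_smul, smul_eq_mul]; nlinarith)
      rw [norm_smul, Real.norm_eq_abs, abs_neg, abs_of_pos (by linarith)] at this
      nlinarith [norm_nonneg (B - A)]
  calc dist B p ≤ dist B A + dist A p := dist_triangle _ _ _
    _ < ε := by rw [dist_eq_norm]; linarith

/-- If the orbit of one point converges to `p`, then so does the orbit of every point. -/
theorem HasQuadraticContact.tendsto_dehomog (hC : HasQuadraticContact D p ℓ)
    (hp : p ∈ frontier D) (hDo : IsOpen D) (hDc : IsPreconnected D)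
    {Φ : ℕ → (ℝ × E) →ₗ[ℝ] (ℝ × E)} (hΦ : ∀ j, ∀ y ∈ coneOver D, Φ j y ∈ coneOver D)
    {q : E} (hq : q ∈ D) (hlim : Tendsto (fun j => dehomog (Φ j (1, q))) atTop (𝓝 p))
    {x : E} (hx : x ∈ D) : Tendsto (fun j => dehomog (Φ j (1, x))) atTop (𝓝 p) := by
  set S := {x | x ∈ D ∧ Tendsto (fun j => dehomog (Φ j (1, x))) atTop (𝓝 p)} with hS
  -- Any two points of a small enough ball are linked by a segment with long prolongations.
  have key : ∀ x₀ ∈ D, ∃ ρ > 0, ∀ a ∈ Metric.ball x₀ ρ, ∀ b ∈ Metric.ball x₀ ρ, a ∈ S → b ∈ S := by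
    intro x₀ hx₀
    obtain ⟨ρ, hρ, hball⟩ := Metric.isOpen_iff.1 hDo x₀ hx₀
    refine ⟨ρ / 2, by positivity, fun a ha b hb haS => ?_⟩
    rw [Metric.mem_ball, dist_eq_norm] at ha hb
    have hab : ‖b - a‖ < ρ := by
      have : b - a = (b - x₀) - (a - x₀) := by abel
      rw [this]; exact (norm_sub_le _ _).trans_lt (by linarith)
    have hhalf : ‖(1 / 2 : ℝ) • (b - a)‖ < ρ / 2 := by
      rw [norm_smul]; norm_num; linarith
    have hseg : segment ℝ (a - (1 / 2 : ℝ) • (b - a)) (b + (1 / 2 : ℝ) • (b - a)) ⊆ D := by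
      refine ((convex_ball x₀ ρ).segment_subset ?_ ?_).trans hball
      · rw [Metric.mem_ball, dist_eq_norm, sub_right_comm]
        exact (norm_sub_le _ _).trans_lt (by linarith)
      · rw [Metric.mem_ball, dist_eq_norm, add_sub_right_comm]
        exact (norm_add_le _ _).trans_lt (by linarith)
    refine ⟨hball ?_, hC.tendsto_of_segment_subset hp hΦ hseg haS.2⟩
    rw [Metric.mem_ball, dist_eq_norm]; linarith
  have hSo : IsOpen S := by
    rw [Metric.isOpen_iff]
    intro x₀ hx₀
    obtain ⟨ρ, hρ, h⟩ := key x₀ hx₀.1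
    exact ⟨ρ, hρ, fun b hb => h x₀ (Metric.mem_ball_self hρ) b hb hx₀⟩
  have hDS : D ⊆ S := by
    refine hDc.subset_of_closure_inter_subset hSo ⟨q, hq, hq, hlim⟩ ?_
    rintro x₀ ⟨hx₀, hx₀D⟩
    obtain ⟨ρ, hρ, h⟩ := key x₀ hx₀D
    obtain ⟨a, ha, had⟩ := Metric.mem_closure_iff.1 hx₀ ρ hρ
    exact h a (by rwa [Metric.mem_ball, dist_comm]) x₀ (Metric.mem_ball_self hρ) ha
  exact (hDS hx).2

/-- A domain with an orbit converging to a boundary point of quadratic contact is convex. -/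
theorem HasQuadraticContact.convex (hC : HasQuadraticContact D p ℓ)
    (hp : p ∈ frontier D) (hDo : IsOpen D) (hDc : IsPreconnected D)
    {Φ : ℕ → (ℝ × E) ≃ₗ[ℝ] (ℝ × E)} (hΦ : ∀ j y, Φ j y ∈ coneOver D ↔ y ∈ coneOver D)
    {q : E} (hq : q ∈ D) (hlim : Tendsto (fun j => dehomog (Φ j (1, q))) atTop (𝓝 p)) :
    Convex ℝ D := by
  rw [convex_iff_segment_subset]
  intro a ha b hb
  have hlim' := fun x (hx : x ∈ D) => hC.tendsto_dehomog hp hDo hDc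
    (Φ := fun j => (Φ j).toLinearMap) (fun j y hy => (hΦ j y).2 hy) hq hlim hx
  obtain ⟨δ, hδ, h⟩ := hC.exists_segment_subset hDo
  obtain ⟨j, hja, hjb⟩ := ((Metric.tendsto_nhds.1 (hlim' a ha) δ hδ).and
    (Metric.tendsto_nhds.1 (hlim' b hb) δ hδ)).exists
  have hA := (hΦ j _).2 (one_mem_coneOver.2 ha)
  have hB := (hΦ j _).2 (one_mem_coneOver.2 hb)
  have hAB := h _ hA.2 _ hB.2 hja hjb
  rintro _ ⟨u, v, hu, hv, huv, rfl⟩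
  rw [← one_mem_coneOver, ← hΦ j]
  have e : ((1 : ℝ), u • a + v • b) = u • (1, a) + v • (1, b) := by
    ext <;> simp [huv]
  have hca := hA.1
  have hcb := hB.1
  have hpos : 0 < u * (Φ j (1, a)).1 + v * (Φ j (1, b)).1 := by
    rcases hu.eq_or_lt with h0 | h0
    · have : v = 1 := by linarith
      rw [← h0, this]; simpa using hcb
    · have : 0 < u * (Φ j (1, a)).1 := by positivity
      have : 0 ≤ v * (Φ j (1, b)).1 := by positivity
      linarith
  rw [e, map_add, map_smul, map_smul]
  refine ⟨by simpa using hpos, hAB ?_⟩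
  set S := u * (Φ j (1, a)).1 + v * (Φ j (1, b)).1 with hS
  refine ⟨S⁻¹ * (u * (Φ j (1, a)).1), S⁻¹ * (v * (Φ j (1, b)).1), by positivity,
    by positivity, by rw [← mul_add, inv_mul_cancel₀ hpos.ne'], ?_⟩
  simp only [Prod.fst_add, Prod.smul_fst, smul_eq_mul, ← hS, Prod.snd_add, Prod.smul_snd, smul_add,
    smul_smul]
  congr 2 <;> field_simp

end Contact

/-! ### Far points of a convex domain, and the scaling maps -/

section Convex

variable {E : Type*} [NormedAddCommGroup E] [NormedSpace ℝ E]

/-- If a convex set lies near its boundary point `s` inside `c ‖x - s‖² ≤ -f (x - s)`, then its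
points at distance at least `σ` from `s` lie in a cone with apex `s`. -/
theorem Convex.mul_norm_sub_le_of_local {D : Set E} (hD : Convex ℝ D) (hDo : IsOpen D) {s : E}
    (hs : s ∈ closure D) {f : E →L[ℝ] ℝ} {c σ ρ : ℝ} (hσ : 0 < σ) (hσρ : σ < ρ)
    (hloc : ∀ x ∈ D, dist x s < ρ → c * ‖x - s‖ ^ 2 ≤ -f (x - s)) {x : E} (hx : x ∈ D)
    (hxs : σ ≤ ‖x - s‖) : c * σ * ‖x - s‖ ≤ -f (x - s) := by
  have h0 : 0 < ‖x - s‖ := hσ.trans_le hxs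
  set θ := σ / ‖x - s‖ with hθ
  have hθ0 : 0 < θ := by positivity
  have hθ1 : θ ≤ 1 := (div_le_one h0).2 hxs
  have hy : (1 - θ) • s + θ • x ∈ D := by
    have := hD.combo_closure_interior_mem_interior hs (hDo.interior_eq.symm ▸ hx)
      (sub_nonneg.2 hθ1) hθ0 (by ring)
    exact interior_subset this
  have hys : (1 - θ) • s + θ • x - s = θ • (x - s) := by module
  have hn : ‖θ • (x - s)‖ = σ := by
    rw [norm_smul, Real.norm_eq_abs, abs_of_pos hθ0, hθ, div_mul_cancel₀ _ h0.ne']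
  have h1 := hloc _ hy (by rw [dist_eq_norm, hys, hn]; exact hσρ)
  rw [hys, hn, map_smul, smul_eq_mul] at h1
  have h2 : θ * ‖x - s‖ = σ := by rw [hθ, div_mul_cancel₀ _ h0.ne']
  have h3 : θ * (c * σ * ‖x - s‖) ≤ θ * (-f (x - s)) := by
    calc θ * (c * σ * ‖x - s‖) = c * σ * (θ * ‖x - s‖) := by ring
      _ = c * σ ^ 2 := by rw [h2]; ring
      _ ≤ _ := by linarith
  exact le_of_mul_le_mul_left h3 hθ0

/-- The cone over `D` is proper: some linear form dominates the norm on it. -/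
theorem HasQuadraticContact.exists_norm_le {D : Set E} {p : E} {ℓ : E → E →L[ℝ] ℝ}
    (hC : HasQuadraticContact D p ℓ) (hD : Convex ℝ D) (hDo : IsOpen D) (hp : p ∈ frontier D) :
    ∃ lam : (ℝ × E) →ₗ[ℝ] ℝ, ∀ y ∈ coneOver D, ‖y‖ ≤ lam y := by
  obtain ⟨δ, hδ, h⟩ := hC.contact (1 / 2) (by norm_num)
  have hpδ : dist p p < δ := by simpa using hδ
  have hloc : ∀ x ∈ D, dist x p < δ → (1 / 2) * ‖x - p‖ ^ 2 ≤ -ℓ p (x - p) := by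
    intro x hx hxp
    have := (h p hp hpδ x hxp).1 hx
    linarith
  set κ := 1 / 2 * (δ / 2) with hκ
  have hκ0 : 0 < κ := by positivity
  have hfar : ∀ x ∈ D, ‖x - p‖ ≤ δ / 2 + κ⁻¹ * (-ℓ p (x - p)) := by
    intro x hx
    rcases le_total (δ / 2) ‖x - p‖ with hle | hle
    · have := hD.mul_norm_sub_le_of_local hDo (frontier_subset_closure hp)
        (half_pos hδ) (half_lt_self hδ) hloc hx hle
      have h2 : ‖x - p‖ ≤ κ⁻¹ * (-ℓ p (x - p)) := by
        rw [le_inv_mul_iff₀ hκ0]; exact this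
      linarith
    · have := hloc x hx (by rw [dist_eq_norm]; linarith)
      have h3 : 0 ≤ -ℓ p (x - p) := le_trans (by positivity) this
      have : 0 ≤ κ⁻¹ * (-ℓ p (x - p)) := by positivity
      linarith
  set C := 1 + ‖p‖ + δ / 2 with hCdef
  set lam : (ℝ × E) →ₗ[ℝ] ℝ := C • LinearMap.fst ℝ ℝ E +
    κ⁻¹ • ((ℓ p p) • LinearMap.fst ℝ ℝ E - (ℓ p).toLinearMap.comp (LinearMap.snd ℝ ℝ E)) with hlam
  have hlam1 : ∀ x ∈ D, ‖((1 : ℝ), x)‖ ≤ lam (1, x) := by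
    intro x hx
    have e : lam (1, x) = C + κ⁻¹ * (-ℓ p (x - p)) := by
      simp [hlam]
    have h1 := hfar x hx
    have h2 : 0 ≤ κ⁻¹ * (-ℓ p (x - p)) := by
      have h3 : 0 ≤ -ℓ p (x - p) := by
        rcases le_total (δ / 2) ‖x - p‖ with hle | hle
        · exact le_trans (by positivity) (hD.mul_norm_sub_le_of_local hDo
            (frontier_subset_closure hp) (half_pos hδ) (half_lt_self hδ) hloc hx hle)
        · exact le_trans (by positivity) (hloc x hx (by rw [dist_eq_norm]; linarith))
      positivity
    have h4 : ‖x‖ ≤ ‖x - p‖ + ‖p‖ := by simpa using norm_add_le (x - p) p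
    rw [e, Prod.norm_def, max_le_iff]
    constructor
    · have := norm_nonneg p
      simp only [norm_one]; linarith
    · simp only; linarith
  refine ⟨lam, fun y hy => ?_⟩
  have hy1 := hy.1
  rw [eq_smul_dehomog hy1.ne', map_smul, norm_smul, Real.norm_eq_abs, abs_of_pos hy1, smul_eq_mul]
  exact mul_le_mul_of_nonneg_left (hlam1 _ hy.2) hy1.le

end Convex

section Sandwich

variable {E : Type*} [NormedAddCommGroup E] [InnerProductSpace ℝ E]

/-- The linear map of `ℝ × E` whose projectivization carries the paraboloid with vertex `s`, inner
unit normal `n` and equation `b² ‖u'‖² < w / h` to the unit ball, and the point `s + h • n` to its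
centre. Here `w` and `u'` are the normal and the tangential part of `x - s`. -/
noncomputable def paraboloidToBall (s n : E) (h b : ℝ) : (ℝ × E) →ₗ[ℝ] (ℝ × E) where
  toFun y := ((y.1 + inner ℝ n (y.2 - y.1 • s) / h) / 2,
    b • (y.2 - y.1 • s - inner ℝ n (y.2 - y.1 • s) • n) +
      ((y.1 - inner ℝ n (y.2 - y.1 • s) / h) / 2) • n)
  map_add' y z := by
    have e : (y + z).2 - (y + z).1 • s = (y.2 - y.1 • s) + (z.2 - z.1 • s) := by
      simp only [Prod.snd_add, Prod.fst_add]; module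
    rw [e, inner_add_right]
    ext
    · simp only [Prod.fst_add]; ring
    · simp only [Prod.snd_add, Prod.fst_add]; module
  map_smul' c y := by
    have e : (c • y).2 - (c • y).1 • s = c • (y.2 - y.1 • s) := by
      simp only [Prod.smul_snd, Prod.smul_fst, smul_eq_mul]; module
    rw [e, inner_smul_right]
    ext
    · simp only [Prod.smul_fst, smul_eq_mul, RingHom.id_apply]; ring
    · simp only [Prod.smul_fst, Prod.smul_snd, smul_eq_mul, RingHom.id_apply]; module

variable {s n : E} {h b : ℝ}

theorem paraboloidToBall_apply (y : ℝ × E) : paraboloidToBall s n h b y =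
    ((y.1 + inner ℝ n (y.2 - y.1 • s) / h) / 2,
    b • (y.2 - y.1 • s - inner ℝ n (y.2 - y.1 • s) • n) +
      ((y.1 - inner ℝ n (y.2 - y.1 • s) / h) / 2) • n) := rfl

theorem norm_sub_inner_smul_sq (hn : ‖n‖ = 1) (u : E) :
    ‖u - (inner ℝ n u : ℝ) • n‖ ^ 2 = ‖u‖ ^ 2 - (inner ℝ n u : ℝ) ^ 2 := by
  rw [norm_sub_sq_real, inner_smul_right, norm_smul, hn, real_inner_comm, Real.norm_eq_abs,
    mul_one, sq_abs]
  ring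

theorem norm_paraboloidToBall_snd_sq (hn : ‖n‖ = 1) (y : ℝ × E) :
    ‖(paraboloidToBall s n h b y).2‖ ^ 2 =
      b ^ 2 * (‖y.2 - y.1 • s‖ ^ 2 - (inner ℝ n (y.2 - y.1 • s) : ℝ) ^ 2) +
      ((y.1 - inner ℝ n (y.2 - y.1 • s) / h) / 2) ^ 2 := by
  have hort : inner ℝ (b • (y.2 - y.1 • s - (inner ℝ n (y.2 - y.1 • s) : ℝ) • n))
      (((y.1 - inner ℝ n (y.2 - y.1 • s) / h) / 2) • n) = 0 := by
    rw [inner_smul_left, inner_smul_right, inner_sub_left, inner_smul_left,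
      real_inner_self_eq_norm_sq, hn, real_inner_comm]
    simp
  rw [paraboloidToBall_apply]
  simp only
  rw [norm_add_sq_real, hort, norm_smul, norm_smul, hn, mul_pow, norm_sub_inner_smul_sq hn,
    Real.norm_eq_abs, Real.norm_eq_abs, sq_abs, mul_one, sq_abs]
  ring

theorem paraboloidToBall_injective (hn : ‖n‖ = 1) (hh : h ≠ 0) (hb : b ≠ 0) :
    Function.Injective (paraboloidToBall s n h b) := by
  rw [← LinearMap.ker_eq_bot, LinearMap.ker_eq_bot']
  intro y hy
  have h2 := norm_paraboloidToBall_snd_sq (s := s) (h := h) (b := b) hn y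
  have h1 := congrArg Prod.fst hy
  rw [hy] at h2
  rw [paraboloidToBall_apply] at h1
  simp only [Prod.fst_zero, Prod.snd_zero, norm_zero] at h1 h2
  set w : ℝ := inner ℝ n (y.2 - y.1 • s) with hw
  have hge : w ^ 2 ≤ ‖y.2 - y.1 • s‖ ^ 2 := by
    have := norm_sub_inner_smul_sq hn (y.2 - y.1 • s)
    have h3 : 0 ≤ ‖y.2 - y.1 • s - (inner ℝ n (y.2 - y.1 • s) : ℝ) • n‖ ^ 2 := by positivity
    linarith
  have h4 : 0 ≤ b ^ 2 * (‖y.2 - y.1 • s‖ ^ 2 - w ^ 2) := mul_nonneg (by positivity) (by linarith)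
  have h5 : y.1 - w / h = 0 := by
    have : ((y.1 - w / h) / 2) ^ 2 = 0 := le_antisymm (by nlinarith) (by positivity)
    have := pow_eq_zero_iff (two_ne_zero) |>.1 this
    linarith
  have h6 : y.1 = 0 := by linarith
  have h7 : w = 0 := by
    have : w / h = 0 := by linarith
    exact (div_eq_zero_iff.1 this).resolve_right hh
  rw [h5, h7] at h2
  have h8 : ‖y.2 - y.1 • s‖ ^ 2 = 0 := by
    have : b ^ 2 * ‖y.2 - y.1 • s‖ ^ 2 = 0 := by linarith
    exact (mul_eq_zero.1 this).resolve_left (by positivity)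
  rw [h6] at h8
  ext
  · exact h6
  · simpa using h8

/-- A linear form that is negative on the open half-space with inner normal `n` is a nonpositive
multiple of `⟪n, ·⟫`. -/
theorem eq_neg_mul_inner_of_neg (hn : ‖n‖ = 1) {f : E →L[ℝ] ℝ}
    (hf : ∀ v, 0 < (inner ℝ n v : ℝ) → f v < 0) :
    (∀ v, f v = -‖f‖ * inner ℝ n v) ∧ 0 < ‖f‖ := by
  have hnn : (inner ℝ n n : ℝ) = 1 := by rw [real_inner_self_eq_norm_sq, hn, one_pow]
  have hfn : f n < 0 := hf n (by rw [hnn]; norm_num)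
  have hle : ∀ v, (inner ℝ n v : ℝ) = 0 → f v ≤ 0 := by
    intro v hv
    by_contra! hpos
    set t := f v / (2 * (-f n)) with ht
    have ht0 : 0 < t := div_pos hpos (by linarith)
    have h1 := hf (v + t • n) (by rw [inner_add_right, inner_smul_right, hv, hnn]; linarith)
    rw [map_add, map_smul, smul_eq_mul] at h1
    have h2 : t * f n = -(f v / 2) := by
      have := hfn.ne
      rw [ht]; field_simp
    linarith
  have hker : ∀ v, (inner ℝ n v : ℝ) = 0 → f v = 0 := by
    intro v hv
    refine le_antisymm (hle v hv) ?_
    have := hle (-v) (by rw [inner_neg_right, hv, neg_zero])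
    rw [map_neg] at this
    linarith
  have hform : ∀ v, f v = f n * inner ℝ n v := by
    intro v
    have := hker (v - (inner ℝ n v : ℝ) • n) (by
      rw [inner_sub_right, inner_smul_right, hnn]; ring)
    rw [map_sub, map_smul, smul_eq_mul] at this
    linarith
  have hnorm : ‖f‖ = -f n := by
    refine le_antisymm (f.opNorm_le_bound (by linarith) fun v => ?_) ?_
    · rw [hform, norm_mul, Real.norm_eq_abs, abs_of_neg hfn]
      have := norm_inner_le_norm (𝕜 := ℝ) n v
      rw [hn, one_mul] at this
      exact mul_le_mul_of_nonneg_left this (by linarith)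
    · have := f.le_opNorm n
      rw [hn, mul_one, Real.norm_eq_abs, abs_of_neg hfn] at this
      exact this
  exact ⟨fun v => by rw [hnorm, neg_neg]; exact hform v, by rw [hnorm]; linarith⟩

/-- Every point of `D` near `p` lies on the inner normal of a boundary point near `p`. -/
theorem HasQuadraticContact.exists_foot [FiniteDimensional ℝ E] {D : Set E} {p : E}
    {ℓ : E → E →L[ℝ] ℝ} (hC : HasQuadraticContact D p ℓ) (hDo : IsOpen D) (hp : p ∈ frontier D) :
    ∃ δ > 0, ∀ z ∈ D, dist z p < δ → ∃ s ∈ frontier D, ∃ n : E, ∃ h : ℝ, ‖n‖ = 1 ∧ 0 < h ∧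
      z = s + h • n ∧ h ≤ dist z p ∧ 0 < ‖ℓ s‖ ∧ ∀ v, ℓ s v = -‖ℓ s‖ * inner ℝ n v := by
  obtain ⟨δ, hδ, hc⟩ := hC.contact (1 / 2) (by norm_num)
  refine ⟨δ / 2, by positivity, fun z hz hzp => ?_⟩
  obtain ⟨s, hs, hsz⟩ := (isClosed_frontier (s := D)).exists_infDist_eq_dist ⟨p, hp⟩ z
  set h := dist z s with hh
  have hmin : ∀ x ∈ frontier D, h ≤ dist z x := fun x hx =>
    hsz ▸ Metric.infDist_le_dist_of_mem hx
  have hsD : s ∉ D := by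
    rw [hDo.frontier_eq] at hs; exact hs.2
  have hzs : z ≠ s := fun e => hsD (e ▸ hz)
  have hh0 : 0 < h := dist_pos.2 hzs
  have hhp : h ≤ dist z p := hmin p hp
  have hball : Metric.ball z h ⊆ D := by
    refine (convex_ball z h).isPreconnected.subset_of_disjoint_frontier hDo
      ⟨z, Metric.mem_ball_self hh0, hz⟩ fun x hx hxf => ?_
    have := hmin x hxf
    rw [Metric.mem_ball, dist_comm] at hx
    linarith
  set n := h⁻¹ • (z - s) with hn
  have hzsn : z = s + h • n := by
    rw [hn, smul_smul, mul_inv_cancel₀ hh0.ne', one_smul, add_sub_cancel]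
  have hn1 : ‖n‖ = 1 := by
    rw [hn, norm_smul, norm_inv, Real.norm_eq_abs, abs_of_pos hh0, ← dist_eq_norm, ← hh,
      inv_mul_cancel₀ hh0.ne']
  have hsp : dist s p < δ := by
    calc dist s p ≤ dist s z + dist z p := dist_triangle _ _ _
      _ < δ := by rw [dist_comm s z]; linarith
  have hneg : ∀ v, 0 < (inner ℝ n v : ℝ) → ℓ s v < 0 := by
    intro v hv
    have hv0 : v ≠ 0 := by rintro rfl; simp at hv
    have hvn : 0 < ‖v‖ := norm_pos_iff.2 hv0
    -- For small `t`, the point `s + t v` lies in the ball around `z` that touches `D` at `s`.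
    set t := min (h * inner ℝ n v / ‖v‖ ^ 2) ((δ - dist s p) / (2 * ‖v‖)) with ht
    have ht0 : 0 < t := lt_min (by positivity) (div_pos (by linarith) (by positivity))
    have ht1 : t * ‖v‖ ^ 2 ≤ h * inner ℝ n v := by
      rw [← le_div_iff₀ (by positivity)]; exact min_le_left _ _
    have ht2 : t * (2 * ‖v‖) ≤ δ - dist s p := by
      rw [← le_div_iff₀ (by positivity)]; exact min_le_right _ _
    have hxD : s + t • v ∈ D := by
      apply hball
      rw [Metric.mem_ball, dist_eq_norm]
      refine lt_of_pow_lt_pow_left₀ 2 hh0.le ?_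
      have e : s + t • v - z = t • v - h • n := by rw [hzsn]; abel
      rw [e, norm_sub_sq_real, inner_smul_left, inner_smul_right, norm_smul, norm_smul, hn1,
        real_inner_comm, Real.norm_eq_abs, Real.norm_eq_abs, abs_of_pos ht0, abs_of_pos hh0]
      simp only [conj_trivial]
      nlinarith [mul_pos ht0 (mul_pos hh0 hv)]
    have hxp : dist (s + t • v) p < δ := by
      calc dist (s + t • v) p ≤ dist (s + t • v) s + dist s p := dist_triangle _ _ _
        _ = t * ‖v‖ + dist s p := by
          rw [dist_eq_norm, add_sub_cancel_left, norm_smul, Real.norm_eq_abs, abs_of_pos ht0]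
        _ < δ := by nlinarith
    have := (hc s hs hsp _ hxp).1 hxD
    rw [add_sub_cancel_left, map_smul, smul_eq_mul] at this
    have h5 : 0 ≤ (1 - 1 / 2) * ‖t • v‖ ^ 2 := by positivity
    have h6 : t * ℓ s v < 0 := by linarith
    exact neg_of_mul_neg_right h6 ht0.le
  obtain ⟨h1, h2⟩ := eq_neg_mul_inner_of_neg hn1 hneg
  exact ⟨s, hs, n, h, hn1, hh0, hzsn, hhp, h2, h1⟩

end Sandwich

/-! ### Squeezing the domain between two balls -/

section Sandwich

variable {E : Type*} [NormedAddCommGroup E] [InnerProductSpace ℝ E]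

variable {s n : E} {h a : ℝ}

theorem norm_paraboloidToBall_one_snd_sq (hn : ‖n‖ = 1) (hh : 0 < h) (ha : 0 < a) (x : E) :
    ‖(paraboloidToBall s n h (√(a * h))⁻¹ (1, x)).2‖ ^ 2 =
      (‖x - s‖ ^ 2 - (inner ℝ n (x - s) : ℝ) ^ 2) / (a * h) +
      ((1 - inner ℝ n (x - s) / h) / 2) ^ 2 := by
  rw [norm_paraboloidToBall_snd_sq hn, inv_pow, Real.sq_sqrt (by positivity), one_smul,
    inv_mul_eq_div]

/-- The upper half of the comparison of `D` with a paraboloid: the outer ball. -/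
theorem norm_paraboloidToBall_le {x : E} {η : ℝ} (hn : ‖n‖ = 1) (hh : 0 < h) (ha : 0 < a)
    (hη : 0 < η) (hw : 0 ≤ (inner ℝ n (x - s) : ℝ))
    (hx : ‖x - s‖ ^ 2 ≤ a * inner ℝ n (x - s) * (1 + 2 * η) ∨
      ‖x - s‖ ^ 2 ≤ η * a / (2 * h) * (inner ℝ n (x - s) : ℝ) ^ 2) :
    ‖(paraboloidToBall s n h (√(a * h))⁻¹ (1, x)).2‖ ≤
      (1 + η) * (paraboloidToBall s n h (√(a * h))⁻¹ (1, x)).1 := by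
  have hfst : (paraboloidToBall s n h (√(a * h))⁻¹ (1, x)).1 = (1 + inner ℝ n (x - s) / h) / 2 := by
    rw [paraboloidToBall_apply, one_smul]
  rw [hfst]
  have hsq := norm_paraboloidToBall_one_snd_sq (s := s) hn hh ha x
  set w : ℝ := inner ℝ n (x - s) with hwdef
  set W := w / h with hW
  have hW0 : 0 ≤ W := by positivity
  have hwW : w = W * h := by rw [hW, div_mul_cancel₀ _ hh.ne']
  rw [← pow_le_pow_iff_left₀ (norm_nonneg _) (by positivity) two_ne_zero, hsq]
  have key : (‖x - s‖ ^ 2 - w ^ 2) / (a * h) ≤ W + η / 2 * (1 + W) ^ 2 := by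
    rw [div_le_iff₀ (by positivity)]
    rcases hx with hx | hx
    · have h1 : a * w * (1 + 2 * η) ≤ (W + η / 2 * (1 + W) ^ 2) * (a * h) := by
        have : (W + η / 2 * (1 + W) ^ 2) * (a * h) - a * w * (1 + 2 * η)
            = η / 2 * (1 - W) ^ 2 * (a * h) := by rw [hwW]; ring
        have h2 : 0 ≤ η / 2 * (1 - W) ^ 2 * (a * h) := by positivity
        linarith
      nlinarith [sq_nonneg w]
    · have h1 : η * a / (2 * h) * w ^ 2 ≤ (W + η / 2 * (1 + W) ^ 2) * (a * h) := by
        have : η * a / (2 * h) * w ^ 2 = η / 2 * W ^ 2 * (a * h) := by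
          rw [hwW]; field_simp
        rw [this]
        have h2 : η / 2 * W ^ 2 ≤ W + η / 2 * (1 + W) ^ 2 := by nlinarith
        exact mul_le_mul_of_nonneg_right h2 (by positivity)
      nlinarith [sq_nonneg w]
  have h3 : 0 ≤ η ^ 2 * ((1 + W) / 2) ^ 2 := by positivity
  nlinarith

/-- The lower half of the comparison of `D` with a paraboloid: the inner ball. -/
theorem pinched_of_norm_paraboloidToBall_lt {x : E} {η : ℝ} (hn : ‖n‖ = 1) (hh : 0 < h)
    (ha : 0 < a) (hη : 0 < η) (hη1 : η < 1) (hsmall : 8 * h ≤ η ^ 2 * a)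
    (hx : ‖(paraboloidToBall s n h (√(a * h))⁻¹ (1, x)).2‖ <
      (1 - η) * (paraboloidToBall s n h (√(a * h))⁻¹ (1, x)).1) :
    -a * inner ℝ n (x - s) + (1 + η / 2) * ‖x - s‖ ^ 2 < 0 ∧ ‖x - s‖ ^ 2 < 4 * a * h / η := by
  have hfst : (paraboloidToBall s n h (√(a * h))⁻¹ (1, x)).1 = (1 + inner ℝ n (x - s) / h) / 2 := by
    rw [paraboloidToBall_apply, one_smul]
  rw [hfst] at hx
  have hsq := norm_paraboloidToBall_one_snd_sq (s := s) hn hh ha x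
  have hort : 0 ≤ ‖x - s‖ ^ 2 - (inner ℝ n (x - s) : ℝ) ^ 2 := by
    rw [← norm_sub_inner_smul_sq hn]; positivity
  set w : ℝ := inner ℝ n (x - s) with hwdef
  set W := w / h with hW
  have hwW : w = W * h := by rw [hW, div_mul_cancel₀ _ hh.ne']
  have hx2 := pow_lt_pow_left₀ hx (norm_nonneg _) two_ne_zero
  rw [hsq] at hx2
  have hτ : 0 < 1 + W := by
    have := (norm_nonneg _).trans_lt hx
    have := pos_of_mul_pos_right this (by linarith)
    linarith
  set X := (‖x - s‖ ^ 2 - w ^ 2) / (a * h) with hX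
  have hX0 : 0 ≤ X := by positivity
  have hXeq : ‖x - s‖ ^ 2 = X * (a * h) + w ^ 2 := by
    rw [hX, div_mul_cancel₀ _ (by positivity)]; ring
  have h1 : X + η * ((1 + W) ^ 2 / 4) < W := by
    have : 0 < η * (1 - η) * (1 + W) ^ 2 := by
      have : 0 < 1 - η := by linarith
      positivity
    nlinarith
  have hW0 : 0 < W := by
    have : 0 ≤ η * ((1 + W) ^ 2 / 4) := by positivity
    linarith
  have hX1 : X < (1 - η) * W := by nlinarith [sq_nonneg (1 - W)]
  have hWη : η * W < 4 := by
    by_contra! hc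
    have : 4 * W ≤ η * W * W := by nlinarith
    nlinarith
  -- The normal coordinate is of order `h`, so its square is negligible.
  have hw2 : w ^ 2 ≤ η / 2 * (a * h) * W := by
    have e : w ^ 2 = (W * h) * (W * h) := by rw [hwW]; ring
    have h2 : 8 * h * (W * h) ≤ η ^ 2 * a * (W * h) :=
      mul_le_mul_of_nonneg_right hsmall (by positivity)
    have h3 : η * ((W * h) * (W * h)) ≤ 4 * h * (W * h) := by
      have : 0 < h * (W * h) := by positivity
      nlinarith
    have h4 : η * w ^ 2 ≤ η * (η / 2 * (a * h) * W) := by rw [e]; nlinarith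
    exact le_of_mul_le_mul_left h4 hη
  have hah : 0 < a * h := by positivity
  have hnorm : ‖x - s‖ ^ 2 < (1 - η / 2) * (W * (a * h)) := by
    rw [hXeq]
    have : X * (a * h) < (1 - η) * W * (a * h) := mul_lt_mul_of_pos_right hX1 hah
    linarith
  have hP : 0 < W * (a * h) := by positivity
  have haw : a * w = W * (a * h) := by rw [hwW]; ring
  constructor
  · have h5 : (1 + η / 2) * ‖x - s‖ ^ 2 < (1 + η / 2) * ((1 - η / 2) * (W * (a * h))) :=
      mul_lt_mul_of_pos_left hnorm (by linarith)
    have h6 : (1 + η / 2) * ((1 - η / 2) * (W * (a * h))) ≤ W * (a * h) := by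
      nlinarith [mul_pos (mul_pos hη hη) hP]
    linarith
  · have h7 : W * (a * h) < 4 * a * h / η := by
      rw [lt_div_iff₀ hη]
      have := mul_lt_mul_of_pos_right hWη hah
      linarith
    have h8 := mul_pos hη hP
    linarith

/-- The preimage of the open unit ball contains no point at infinity. -/
theorem fst_pos_of_norm_paraboloidToBall_lt {b : ℝ} (hn : ‖n‖ = 1) {y : ℝ × E}
    (hy : ‖(paraboloidToBall s n h b y).2‖ < (paraboloidToBall s n h b y).1) : 0 < y.1 := by
  have hort : 0 ≤ ‖y.2 - y.1 • s‖ ^ 2 - (inner ℝ n (y.2 - y.1 • s) : ℝ) ^ 2 := by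
    rw [← norm_sub_inner_smul_sq hn]; positivity
  have hτ := (norm_nonneg _).trans_lt hy
  have h2 := pow_lt_pow_left₀ hy (norm_nonneg _) two_ne_zero
  rw [norm_paraboloidToBall_snd_sq hn] at h2
  have hfst : (paraboloidToBall s n h b y).1 = (y.1 + inner ℝ n (y.2 - y.1 • s) / h) / 2 := rfl
  rw [hfst] at h2 hτ
  set W : ℝ := inner ℝ n (y.2 - y.1 • s) / h with hW
  have h3 : 0 ≤ b ^ 2 * (‖y.2 - y.1 • s‖ ^ 2 - (inner ℝ n (y.2 - y.1 • s) : ℝ) ^ 2) := by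
    positivity
  have h4 : 0 < y.1 * W := by linarith
  by_contra! hneg
  have hWp : 0 < W := by linarith
  linarith [mul_nonpos_of_nonpos_of_nonneg hneg hWp.le]

/-- Near `p` the domain looks like a ball: for `z ∈ D` close to `p`, a projective map sends `z` to
the origin and `D` to a set squeezed between two balls about the origin of radii close to `1`. -/
theorem HasQuadraticContact.exists_sandwich [FiniteDimensional ℝ E] {D : Set E} {p : E}
    {ℓ : E → E →L[ℝ] ℝ} (hC : HasQuadraticContact D p ℓ) (hD : Convex ℝ D) (hDo : IsOpen D)
    (hp : p ∈ frontier D) {η : ℝ} (hη : 0 < η) (hη1 : η < 1) :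
    ∃ δ > 0, ∀ z ∈ D, dist z p < δ → ∃ L : (ℝ × E) ≃ₗ[ℝ] (ℝ × E), L (1, z) = (1, 0) ∧
      (∀ y ∈ coneOver D, ‖(L y).2‖ ≤ (1 + η) * (L y).1) ∧
      ∀ y, ‖(L y).2‖ < (1 - η) * (L y).1 → y ∈ coneOver D := by
  obtain ⟨δ₁, hδ₁, hc⟩ := hC.contact (η / 2) (by positivity)
  obtain ⟨δ₂, hδ₂, hfoot⟩ := hC.exists_foot hDo hp
  have hN : 0 < ‖ℓ p‖ := norm_pos_iff.2 hC.ne_zero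
  set N := ‖ℓ p‖ with hNdef
  have hcont : ∀ᶠ s in 𝓝 p, N / 2 < ‖ℓ s‖ ∧ ‖ℓ s‖ < 2 * N := by
    have ht : Tendsto (fun s => ‖ℓ s‖) (𝓝 p) (𝓝 N) := hC.continuousAt.norm
    exact (ht.eventually (lt_mem_nhds (by linarith))).and (ht.eventually (gt_mem_nhds (by linarith)))
  obtain ⟨δ₃, hδ₃, hℓ⟩ := Metric.eventually_nhds_iff.1 hcont
  set κ := δ₁ / 4 with hκ
  have hκ0 : 0 < κ := by positivity
  set H := min (η * κ ^ 2 / (4 * N)) (min (η ^ 2 * N / 16) (η * δ₁ ^ 2 / (32 * N))) with hH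
  have hH0 : 0 < H := by positivity
  refine ⟨min δ₂ (min (δ₃ / 2) (min (δ₁ / 8) H)), by positivity, fun z hz hzp => ?_⟩
  simp only [lt_min_iff] at hzp
  obtain ⟨hz2, hz3, hz1, hzH⟩ := hzp
  obtain ⟨s, hs, n, h, hn, hh, hzs, hhz, ha, hform⟩ := hfoot z hz hz2
  have hsp : dist s p ≤ 2 * dist z p := by
    have hsz : dist s z = h := by
      rw [dist_eq_norm, hzs, sub_add_cancel_left, norm_neg, norm_smul, hn, Real.norm_eq_abs,
        abs_of_pos hh, mul_one]
    calc dist s p ≤ dist s z + dist z p := dist_triangle _ _ _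
      _ ≤ 2 * dist z p := by rw [hsz]; linarith
  obtain ⟨ha0, ha1⟩ := hℓ (by linarith : dist s p < δ₃)
  set a := ‖ℓ s‖ with hadef
  have hhH : h < H := hhz.trans_lt hzH
  have hh1 : h * (4 * N) ≤ η * κ ^ 2 := by
    rw [← le_div_iff₀ (by positivity)]; exact hhH.le.trans (min_le_left _ _)
  have hh2 : h ≤ η ^ 2 * N / 16 := hhH.le.trans ((min_le_right _ _).trans (min_le_left _ _))
  have hh3 : h * (32 * N) ≤ η * δ₁ ^ 2 := by
    rw [← le_div_iff₀ (by positivity)]; exact hhH.le.trans ((min_le_right _ _).trans (min_le_right _ _))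
  have hs1 : dist s p < δ₁ / 4 := by linarith
  have hball : ∀ x, ‖x - s‖ < 3 * δ₁ / 4 → dist x p < δ₁ := by
    intro x hx
    rw [← dist_eq_norm] at hx
    linarith [dist_triangle x s p]
  set b := (√(a * h))⁻¹ with hb
  have hb0 : b ≠ 0 := by positivity
  set L := LinearEquiv.ofInjectiveEndo (paraboloidToBall s n h b)
    (paraboloidToBall_injective hn hh.ne' hb0) with hL
  have hLapp : ∀ y, L y = paraboloidToBall s n h b y := fun y => rfl
  have hnn : (inner ℝ n n : ℝ) = 1 := by rw [real_inner_self_eq_norm_sq, hn, one_pow]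
  refine ⟨L, ?_, ?_, ?_⟩
  · rw [hLapp, paraboloidToBall_apply]
    simp only [one_smul, hzs, add_sub_cancel_left, inner_smul_right, hnn, mul_one, sub_self,
      smul_zero, zero_add, div_self hh.ne']
    ext <;> norm_num
  · have hone : ∀ x ∈ D, ‖(L (1, x)).2‖ ≤ (1 + η) * (L (1, x)).1 := by
      intro x hx
      have hloc : ∀ x ∈ D, dist x s < 3 * δ₁ / 4 →
          (1 - η / 2) * ‖x - s‖ ^ 2 ≤ a * inner ℝ n (x - s) := by
        intro x hx hxs
        have := (hc s hs (by linarith) x (hball x (by rwa [← dist_eq_norm]))).1 hx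
        rw [hform] at this
        linarith
      have hη2 : 1 / 2 < 1 - η / 2 := by linarith
      rcases lt_or_ge ‖x - s‖ (δ₁ / 2) with hlt | hge
      · have h1 := hloc x hx (by rw [dist_eq_norm]; linarith)
        have hw : 0 ≤ (inner ℝ n (x - s) : ℝ) := by
          refine nonneg_of_mul_nonneg_right (le_trans ?_ h1) ha
          have : 0 ≤ 1 - η / 2 := by linarith
          positivity
        refine norm_paraboloidToBall_le hn hh ha hη hw (Or.inl ?_)
        calc ‖x - s‖ ^ 2 ≤ (1 - η / 2) * ‖x - s‖ ^ 2 * (1 + 2 * η) := by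
              nlinarith [sq_nonneg ‖x - s‖, mul_nonneg hη.le (sq_nonneg ‖x - s‖),
                mul_nonneg (mul_nonneg hη.le (sub_nonneg.2 hη1.le)) (sq_nonneg ‖x - s‖)]
          _ ≤ _ := mul_le_mul_of_nonneg_right h1 (by linarith)
      · have h1 := hD.mul_norm_sub_le_of_local hDo (frontier_subset_closure hs) (f := ℓ s)
          (c := 1 / 2) (σ := δ₁ / 2) (ρ := 3 * δ₁ / 4) (by positivity) (by linarith) (by
            intro x hx hxs
            have := hloc x hx hxs
            rw [hform]
            nlinarith [sq_nonneg ‖x - s‖]) hx hge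
        have h2 : κ * ‖x - s‖ ≤ a * inner ℝ n (x - s) := by
          rw [hform] at h1
          rw [hκ]
          linarith
        set w : ℝ := inner ℝ n (x - s) with hw
        have hw0 : 0 ≤ w := nonneg_of_mul_nonneg_right (le_trans (by positivity) h2) ha
        refine norm_paraboloidToBall_le hn hh ha hη hw0 (Or.inr ?_)
        rw [← hw]
        have h3 : κ ^ 2 * ‖x - s‖ ^ 2 ≤ a ^ 2 * w ^ 2 := by
          have := pow_le_pow_left₀ (by positivity) h2 2
          rwa [mul_pow, mul_pow] at this
        have h4 : a ^ 2 * w ^ 2 ≤ κ ^ 2 * (η * a / (2 * h) * w ^ 2) := by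
          have h5 : 2 * h * a ≤ η * κ ^ 2 := by linarith [mul_lt_mul_of_pos_left ha1 hh]
          have h6 : κ ^ 2 * (η * a / (2 * h) * w ^ 2) = η * κ ^ 2 / (2 * h) * (a * w ^ 2) := by
            ring
          rw [h6]
          have h7 : a ≤ η * κ ^ 2 / (2 * h) := by
            rw [le_div_iff₀ (by positivity)]; linarith
          calc a ^ 2 * w ^ 2 = a * (a * w ^ 2) := by ring
            _ ≤ _ := mul_le_mul_of_nonneg_right h7 (by positivity)
        exact le_of_mul_le_mul_left (h3.trans h4) (by positivity)
    intro y hy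
    have hy1 := hy.1
    have h1 := hone _ hy.2
    rw [eq_smul_dehomog hy1.ne', map_smul, Prod.smul_snd, Prod.smul_fst, norm_smul,
      Real.norm_eq_abs, abs_of_pos hy1, smul_eq_mul]
    calc _ ≤ y.1 * ((1 + η) * (L (1, dehomog y)).1) := mul_le_mul_of_nonneg_left h1 hy1.le
      _ = _ := by ring
  · intro y hy
    have hη0 : 0 < 1 - η := by linarith
    have hτ : 0 < (L y).1 := pos_of_mul_pos_right ((norm_nonneg _).trans_lt hy) hη0.le
    have hy1 : 0 < y.1 := by
      refine fst_pos_of_norm_paraboloidToBall_lt (s := s) (h := h) (b := b) hn ?_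
      rw [← hLapp]
      linarith [mul_pos hη hτ]
    rw [eq_smul_dehomog hy1.ne', smul_mem_coneOver hy1, one_mem_coneOver]
    rw [eq_smul_dehomog hy1.ne', map_smul, Prod.smul_snd, Prod.smul_fst, norm_smul,
      Real.norm_eq_abs, abs_of_pos hy1, smul_eq_mul] at hy
    have hx : ‖(L (1, dehomog y)).2‖ < (1 - η) * (L (1, dehomog y)).1 := by
      refine lt_of_mul_lt_mul_left (a := y.1) ?_ hy1.le
      linarith
    obtain ⟨h1, h2⟩ := pinched_of_norm_paraboloidToBall_lt hn hh ha hη hη1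
      (by linarith [mul_le_mul_of_nonneg_left ha0.le (sq_nonneg η)]) hx
    have h3 : ‖dehomog y - s‖ < δ₁ / 2 := by
      refine lt_of_pow_lt_pow_left₀ 2 (by positivity) (h2.trans_le ?_)
      rw [div_le_iff₀ hη]
      linarith [mul_lt_mul_of_pos_left ha1 hh]
    refine (hc s hs (by linarith) _ (hball _ (by linarith))).2 ?_
    rw [hform]
    exact h1

end Sandwich

/-! ### Passing to the limit -/

section Limit

variable {E : Type*} [NormedAddCommGroup E] [NormedSpace ℝ E]

/-- A linear map that is bounded by `C` on a ball of radius `ρ` has norm at most `2 C / ρ`. -/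
theorem ContinuousLinearMap.opNorm_le_of_forall_norm_le {F G : Type*} [NormedAddCommGroup F]
    [NormedSpace ℝ F] [NormedAddCommGroup G] [NormedSpace ℝ G] (f : F →L[ℝ] G) {ρ C : ℝ}
    (hρ : 0 < ρ) (hC : 0 ≤ C) (h : ∀ x, ‖x‖ < ρ → ‖f x‖ ≤ C) : ‖f‖ ≤ 2 * C / ρ := by
  refine ContinuousLinearMap.opNorm_le_of_shell hρ (by positivity) (c := (2 : ℝ)) (by norm_num) ?_
  intro x hx1 hx2
  have h2 : ρ / 2 ≤ ‖x‖ := by simpa using hx1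
  calc ‖f x‖ ≤ C := h x hx2
    _ = 2 * C / ρ * (ρ / 2) := by field_simp
    _ ≤ 2 * C / ρ * ‖x‖ := by gcongr

/-- If projective images of `D`, the cone over which is proper, normalized by sending a fixed point `q`
to the origin, are squeezed between balls of radii tending to `1`, then `D` is itself
projectively equivalent to the unit ball. -/
theorem exists_equiv_coneOver_ball_of_sandwich [FiniteDimensional ℝ E] {D : Set E} (hDo : IsOpen D)
    {q : E} (hq : q ∈ D) {lam : (ℝ × E) →ₗ[ℝ] ℝ} (hlam : ∀ y ∈ coneOver D, ‖y‖ ≤ lam y)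
    (h : ∀ η : ℝ, 0 < η → η < 1 → ∃ L : (ℝ × E) ≃ₗ[ℝ] (ℝ × E), L (1, q) = (1, 0) ∧
      (∀ y ∈ coneOver D, ‖(L y).2‖ ≤ (1 + η) * (L y).1) ∧
      ∀ y, ‖(L y).2‖ < (1 - η) * (L y).1 → y ∈ coneOver D) :
    ∃ L : (ℝ × E) ≃ₗ[ℝ] (ℝ × E), ∀ y, L y ∈ coneOver (Metric.ball 0 1) ↔ y ∈ coneOver D := by
  set η : ℕ → ℝ := fun j => 1 / 2 * (1 / ((j : ℝ) + 1)) with hη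
  have hη0 : ∀ j, 0 < η j := fun j => by positivity
  have hη2 : ∀ j, η j ≤ 1 / 2 := fun j => by
    have : 1 / ((j : ℝ) + 1) ≤ 1 := by
      rw [div_le_one (by positivity)]
      have : (0 : ℝ) ≤ j := Nat.cast_nonneg j
      linarith
    simp only [hη]; linarith
  have hηlim : Tendsto η atTop (𝓝 0) := by
    have := (tendsto_one_div_add_atTop_nhds_zero_nat (𝕜 := ℝ)).const_mul (1 / 2 : ℝ)
    rwa [mul_zero] at this
  choose L hLq hLup hLlow using fun j => h (η j) (hη0 j) (by linarith [hη2 j])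
  set A : ℕ → (ℝ × E) →L[ℝ] (ℝ × E) := fun j => (L j).toContinuousLinearEquiv with hA
  set B : ℕ → (ℝ × E) →L[ℝ] (ℝ × E) := fun j => (L j).toContinuousLinearEquiv.symm with hB
  have hAapp : ∀ j y, A j y = L j y := fun j y => rfl
  have hqc : ((1 : ℝ), q) ∈ coneOver D := one_mem_coneOver.2 hq
  -- Both bounds come from decomposing `2 (1, q) = ((1, q) + y) + ((1, q) - y)` inside the cone.
  obtain ⟨ρ, hρ, hball⟩ := Metric.isOpen_iff.1 (isOpen_coneOver hDo) _ hqc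
  have hAbdd : ∀ j, ‖A j‖ ≤ 2 * 4 / ρ := by
    intro j
    refine (A j).opNorm_le_of_forall_norm_le hρ (by norm_num) fun y hy => ?_
    have h1 := hLup j ((1, q) + y) (hball (by simpa [Metric.mem_ball, dist_eq_norm] using hy))
    have h2 := hLup j ((1, q) - y) (hball (by simpa [Metric.mem_ball, dist_eq_norm] using hy))
    rw [map_add, hLq] at h1
    rw [map_sub, hLq] at h2
    simp only [Prod.snd_add, Prod.fst_add, Prod.snd_sub, Prod.fst_sub, zero_add, zero_sub,
      norm_neg] at h1 h2
    have hj := hη0 j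
    have hj2 := hη2 j
    have h3 := (norm_nonneg _).trans h1
    have h4 := (norm_nonneg _).trans h2
    have h5 : -1 ≤ (L j y).1 := by
      have := nonneg_of_mul_nonneg_right h3 (by linarith); linarith
    have h6 : (L j y).1 ≤ 1 := by
      have := nonneg_of_mul_nonneg_right h4 (by linarith); linarith
    rw [hAapp, Prod.norm_def, max_le_iff]
    refine ⟨by rw [Real.norm_eq_abs, abs_le]; constructor <;> linarith, ?_⟩
    nlinarith
  have hBbdd : ∀ j, ‖B j‖ ≤ 2 * |lam (1, q)| / (1 / 4) := by
    intro j
    refine (B j).opNorm_le_of_forall_norm_le (by norm_num) (abs_nonneg _) fun y hy => ?_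
    obtain ⟨hy1, hy2⟩ := max_lt_iff.1 (Prod.norm_def y ▸ hy)
    rw [Real.norm_eq_abs, abs_lt] at hy1
    have hj := hη0 j
    have hj2 := hη2 j
    have e : L j (B j y) = y := (L j).apply_symm_apply y
    have h1 := hlam _ (hLlow j ((1, q) + B j y) (by
      rw [map_add, hLq, e]
      simp only [Prod.snd_add, Prod.fst_add, zero_add]
      nlinarith))
    have h2 := hlam _ (hLlow j ((1, q) - B j y) (by
      rw [map_sub, hLq, e]
      simp only [Prod.snd_sub, Prod.fst_sub, zero_sub, norm_neg]
      nlinarith))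
    rw [map_add] at h1
    rw [map_sub] at h2
    have h3 : ‖B j y + B j y‖ ≤ ‖(1, q) + B j y‖ + ‖(1, q) - B j y‖ := by
      have : B j y + B j y = ((1, q) + B j y) - ((1, q) - B j y) := by abel
      rw [this]; exact norm_sub_le _ _
    have h4 : ‖B j y + B j y‖ = 2 * ‖B j y‖ := by
      rw [← two_smul ℝ (B j y), norm_smul]; norm_num
    have := le_abs_self (lam (1, q))
    linarith
  have hbdd : Bornology.IsBounded ((Metric.closedBall (0 : (ℝ × E) →L[ℝ] (ℝ × E)) (2 * 4 / ρ)) ×ˢ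
      (Metric.closedBall (0 : (ℝ × E) →L[ℝ] (ℝ × E)) (2 * |lam (1, q)| / (1 / 4)))) :=
    Metric.isBounded_closedBall.prod Metric.isBounded_closedBall
  have : ProperSpace ((ℝ × E) →L[ℝ] (ℝ × E)) := FiniteDimensional.proper_real _
  obtain ⟨⟨A₀, B₀⟩, -, ψ, hψ, hlim⟩ := tendsto_subseq_of_bounded hbdd
    (x := fun j => (A j, B j)) fun j => ⟨by simpa using hAbdd j, by simpa using hBbdd j⟩
  have hlimA : Tendsto (fun j => A (ψ j)) atTop (𝓝 A₀) := (continuous_fst.tendsto _).comp hlim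
  have hlimB : Tendsto (fun j => B (ψ j)) atTop (𝓝 B₀) := (continuous_snd.tendsto _).comp hlim
  have hAB : A₀ * B₀ = 1 := by
    refine tendsto_nhds_unique (hlimA.mul hlimB) ?_
    have : ∀ j, A (ψ j) * B (ψ j) = 1 := fun j =>
      ContinuousLinearMap.ext fun y => (L (ψ j)).apply_symm_apply y
    simp only [this]
    exact tendsto_const_nhds
  have hBA : B₀ * A₀ = 1 := by
    refine tendsto_nhds_unique (hlimB.mul hlimA) ?_
    have : ∀ j, B (ψ j) * A (ψ j) = 1 := fun j =>
      ContinuousLinearMap.ext fun y => (L (ψ j)).symm_apply_apply y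
    simp only [this]
    exact tendsto_const_nhds
  have hApt : ∀ y, Tendsto (fun j => A (ψ j) y) atTop (𝓝 (A₀ y)) := fun y =>
    ((ContinuousLinearMap.apply ℝ (ℝ × E) y).continuous.tendsto _).comp hlimA
  have hηψ : Tendsto (fun j => η (ψ j)) atTop (𝓝 0) := hηlim.comp hψ.tendsto_atTop
  have hfst : ∀ y, Tendsto (fun j => (A (ψ j) y).1) atTop (𝓝 (A₀ y).1) := fun y =>
    (continuous_fst.tendsto _).comp (hApt y)
  have hsnd : ∀ y, Tendsto (fun j => ‖(A (ψ j) y).2‖) atTop (𝓝 ‖(A₀ y).2‖) := fun y =>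
    ((continuous_snd.tendsto _).comp (hApt y)).norm
  have hA₀q : A₀ (1, q) = (1, 0) :=
    tendsto_nhds_unique (hApt (1, q)) (by simp only [hAapp, hLq]; exact tendsto_const_nhds)
  have hle : ∀ y ∈ coneOver D, ‖(A₀ y).2‖ ≤ (A₀ y).1 := by
    intro y hy
    have h1 : Tendsto (fun j => (1 + η (ψ j)) * (A (ψ j) y).1) atTop (𝓝 ((1 + 0) * (A₀ y).1)) :=
      (hηψ.const_add 1).mul (hfst y)
    rw [add_zero, one_mul] at h1
    exact le_of_tendsto_of_tendsto' (hsnd y) h1 fun j => hLup (ψ j) y hy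
  refine ⟨LinearEquiv.ofLinearMap A₀.toLinearMap B₀.toLinearMap
    (LinearMap.ext fun y => DFunLike.congr_fun hAB y)
    (LinearMap.ext fun y => DFunLike.congr_fun hBA y), fun y => ?_⟩
  rw [mem_coneOver_ball]
  change ‖(A₀ y).2‖ < (A₀ y).1 ↔ _
  constructor
  · intro hy
    have h1 : Tendsto (fun j => (1 - η (ψ j)) * (A (ψ j) y).1) atTop (𝓝 ((1 - 0) * (A₀ y).1)) :=
      (tendsto_const_nhds.sub hηψ).mul (hfst y)
    rw [sub_zero, one_mul] at h1
    obtain ⟨j, hj⟩ := ((hsnd y).eventually_lt h1 hy).exists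
    exact hLlow (ψ j) y hj
  · intro hy
    -- Moving `y` slightly away from `(1, q)` inside the open cone makes the inequality strict.
    have hcont : Tendsto (fun t : ℝ => y - t • ((1 : ℝ), q)) (𝓝 0) (𝓝 (y - (0 : ℝ) • ((1 : ℝ), q))) :=
      Continuous.tendsto (by fun_prop) 0
    rw [zero_smul, sub_zero] at hcont
    have hev := hcont.eventually ((isOpen_coneOver hDo).mem_nhds hy)
    obtain ⟨ε, hε, h1⟩ := Metric.eventually_nhds_iff.1 hev
    have h2 := hle _ (h1 (y := ε / 2) (by simp [abs_of_pos hε]; linarith))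
    rw [map_sub, map_smul, hA₀q] at h2
    simp only [Prod.snd_sub, Prod.fst_sub, Prod.smul_snd, Prod.smul_fst, smul_zero, sub_zero,
      smul_eq_mul, mul_one] at h2
    linarith

end Limit

/-! ### Rigidity in homogeneous coordinates -/

section Rigidity

variable {E : Type*} [NormedAddCommGroup E] [InnerProductSpace ℝ E] [FiniteDimensional ℝ E]

/-- The theorem in homogeneous coordinates: automorphisms of the cone over `D` that move a point of
`D` to a boundary point of quadratic contact force the cone to be a Lorentz cone. -/
theorem HasQuadraticContact.exists_equiv_coneOver_ball {D : Set E} {p : E} {ℓ : E → E →L[ℝ] ℝ}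
    (hC : HasQuadraticContact D p ℓ) (hp : p ∈ frontier D) (hDo : IsOpen D)
    (hDc : IsPreconnected D) {Φ : ℕ → (ℝ × E) ≃ₗ[ℝ] (ℝ × E)}
    (hΦ : ∀ j y, Φ j y ∈ coneOver D ↔ y ∈ coneOver D) {q : E} (hq : q ∈ D)
    (hlim : Tendsto (fun j => dehomog (Φ j (1, q))) atTop (𝓝 p)) :
    ∃ L : (ℝ × E) ≃ₗ[ℝ] (ℝ × E), ∀ y, L y ∈ coneOver (Metric.ball 0 1) ↔ y ∈ coneOver D := by
  have hD := hC.convex hp hDo hDc hΦ hq hlim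
  obtain ⟨lam, hlam⟩ := hC.exists_norm_le hD hDo hp
  refine exists_equiv_coneOver_ball_of_sandwich hDo hq hlam fun η hη hη1 => ?_
  obtain ⟨δ, hδ, hsand⟩ := hC.exists_sandwich hD hDo hp hη hη1
  obtain ⟨j, hj⟩ := (Metric.tendsto_nhds.1 hlim δ hδ).exists
  obtain ⟨hc, hz⟩ := (hΦ j _).2 (one_mem_coneOver.2 hq)
  obtain ⟨L, hL1, hL2, hL3⟩ := hsand _ hz hj
  -- `Φ j (1, q)` is only a positive multiple of the homogeneous coordinates of its affine point.
  set c := (Φ j (1, q)).1 with hcdef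
  have hL : ∀ y, ((Φ j).trans (L.trans (LinearEquiv.smulOfNeZero ℝ (ℝ × E) c⁻¹
      (inv_ne_zero hc.ne')))) y = c⁻¹ • L (Φ j y) := fun y => rfl
  refine ⟨(Φ j).trans (L.trans (LinearEquiv.smulOfNeZero ℝ (ℝ × E) c⁻¹ (inv_ne_zero hc.ne'))),
    ?_, fun y hy => ?_, fun y hy => ?_⟩
  · rw [hL, eq_smul_dehomog (y := Φ j (1, q)) hc.ne', map_smul]
    change c⁻¹ • c • L (1, (c⁻¹ • (Φ j (1, q)).2)) = _
    rw [hL1, smul_smul, inv_mul_cancel₀ hc.ne', one_smul]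
  · rw [hL, ← map_smul]
    exact hL2 _ ((smul_mem_coneOver (inv_pos.2 hc)).2 ((hΦ j y).2 hy))
  · rw [hL, ← map_smul] at hy
    exact (hΦ j y).1 ((smul_mem_coneOver (inv_pos.2 hc)).1 (hL3 _ hy))

end Rigidity

/-! ### Taylor expansion and normalization of the Hessian -/

section Taylor

variable {E : Type*} [NormedAddCommGroup E] [NormedSpace ℝ E]

/-- Second order Taylor expansion at a variable base point `s` near `p`, with the Hessian frozen
at `p`. -/
theorem exists_taylor_two_of_contDiffAt {r : E → ℝ} {p : E} (hr : ContDiffAt ℝ 2 r p) {ε : ℝ}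
    (hε : 0 < ε) : ∃ δ > 0, ∀ s x, dist s p < δ → dist x p < δ →
      |r x - r s - fderiv ℝ r s (x - s) - 1 / 2 * fderiv ℝ (fderiv ℝ r) p (x - s) (x - s)| ≤
        ε * ‖x - s‖ ^ 2 := by
  set B := fderiv ℝ (fderiv ℝ r) p with hB
  have hstrict : HasStrictFDerivAt (fderiv ℝ r) B p :=
    (hr.fderiv_right (m := 1) (by norm_num)).hasStrictFDerivAt (by norm_num)
  have hsymm : ∀ u v, B u v = B v u := fun u v =>
    (hr.isSymmSndFDerivAt (by simp)).eq u v
  have h1 : ∀ᶠ z : E × E in 𝓝 (p, p),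
      ‖fderiv ℝ r z.1 - fderiv ℝ r z.2 - B (z.1 - z.2)‖ ≤ ε * ‖z.1 - z.2‖ :=
    hstrict.isLittleO.def hε
  have h2 : ∀ᶠ y in 𝓝 p, DifferentiableAt ℝ r y :=
    (hr.eventually (by simp)).mono fun y hy => hy.differentiableAt (by norm_num)
  obtain ⟨δ₁, hδ₁, h1⟩ := Metric.eventually_nhds_iff.1 h1
  obtain ⟨δ₂, hδ₂, h2⟩ := Metric.eventually_nhds_iff.1 h2
  refine ⟨min δ₁ δ₂, by positivity, fun s x hs hx => ?_⟩
  have hseg : segment ℝ s x ⊆ Metric.ball p (min δ₁ δ₂) :=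
    (convex_ball _ _).segment_subset hs hx
  have hderiv : ∀ y ∈ segment ℝ s x, HasFDerivWithinAt
      (fun y => r y - fderiv ℝ r s y - 1 / 2 * B (y - s) (y - s))
      (fderiv ℝ r y - fderiv ℝ r s - B (y - s)) (segment ℝ s x) y := by
    intro y hy
    have hd := (h2 (lt_of_lt_of_le (hseg hy) (min_le_right _ _))).hasFDerivAt
    have hid : HasFDerivAt (fun y : E => y - s) (ContinuousLinearMap.id ℝ E) y :=
      (hasFDerivAt_id y).sub_const s
    have hq := (((B.hasFDerivAt (x := y - s)).comp y hid).clm_apply hid).const_mul (1 / 2 : ℝ)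
    refine (((hd.sub (fderiv ℝ r s).hasFDerivAt).sub hq).congr_fderiv ?_).hasFDerivWithinAt
    ext v
    simp [hsymm v y, hsymm v s]
    ring
  have hbound : ∀ y ∈ segment ℝ s x, ‖fderiv ℝ r y - fderiv ℝ r s - B (y - s)‖ ≤ ε * ‖x - s‖ := by
    intro y hy
    have := h1 (y := (y, s)) (by
      rw [Prod.dist_eq]
      exact max_lt ((hseg hy).trans_le (min_le_left _ _)) (hs.trans_le (min_le_left _ _)))
    refine this.trans (mul_le_mul_of_nonneg_left ?_ hε.le)
    have := norm_sub_le_of_mem_segment hy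
    simpa using this
  have := (convex_segment s x).norm_image_sub_le_of_norm_hasFDerivWithin_le hderiv hbound
    (left_mem_segment ℝ s x) (right_mem_segment ℝ s x)
  rw [Real.norm_eq_abs] at this
  simp only [sub_self, map_zero, mul_zero, sub_zero] at this
  rw [map_sub]
  calc _ = _ := by congr 1; ring
    _ ≤ _ := this
    _ = _ := by ring

/-- A quadratic form that is positive definite on the kernel of a linear form `f` becomes positive
definite when a large multiple of `f²` is added. -/
theorem exists_add_mul_sq_pos [FiniteDimensional ℝ E] (B : E →L[ℝ] E →L[ℝ] ℝ) (f : E →L[ℝ] ℝ)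
    (h : ∀ v, v ≠ 0 → f v = 0 → 0 < B v v) :
    ∃ K : ℝ, 0 ≤ K ∧ ∀ v, v ≠ 0 → 0 < B v v + K * f v ^ 2 := by
  have : ProperSpace E := FiniteDimensional.proper_real E
  suffices hS : ∃ K : ℝ, 0 ≤ K ∧ ∀ v ∈ Metric.sphere (0 : E) 1, 0 < B v v + K * f v ^ 2 by
    obtain ⟨K, hK, hS⟩ := hS
    refine ⟨K, hK, fun v hv => ?_⟩
    have hn : 0 < ‖v‖ := norm_pos_iff.2 hv
    have h1 := hS (‖v‖⁻¹ • v) (by simp [norm_smul, hn.ne'])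
    have e : B (‖v‖⁻¹ • v) (‖v‖⁻¹ • v) + K * f (‖v‖⁻¹ • v) ^ 2 =
        (‖v‖⁻¹) ^ 2 * (B v v + K * f v ^ 2) := by
      simp; ring
    rw [e] at h1
    exact pos_of_mul_pos_right h1 (by positivity)
  have hcB : Continuous fun v => B v v := by fun_prop
  have hcpt : IsCompact (Metric.sphere (0 : E) 1 ∩ {v | B v v ≤ 0}) :=
    (isCompact_sphere 0 1).inter_right (isClosed_le hcB continuous_const)
  rcases (Metric.sphere (0 : E) 1 ∩ {v | B v v ≤ 0}).eq_empty_or_nonempty with he | hne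
  · refine ⟨0, le_rfl, fun v hv => ?_⟩
    by_contra! hle
    have : v ∈ Metric.sphere (0 : E) 1 ∩ {v | B v v ≤ 0} := ⟨hv, by simpa using hle⟩
    rw [he] at this
    exact this
  · obtain ⟨v₀, ⟨hv₀, hBv₀⟩, hmin⟩ := hcpt.exists_isMinOn hne
      (f := fun v => f v ^ 2) (by fun_prop)
    have hv₀0 : v₀ ≠ 0 := by rintro rfl; simp at hv₀
    have hm : 0 < f v₀ ^ 2 := by
      have : f v₀ ≠ 0 := fun h0 => absurd (h v₀ hv₀0 h0) (not_lt.2 hBv₀)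
      positivity
    refine ⟨(‖B‖ + 1) / f v₀ ^ 2, by positivity, fun v hv => ?_⟩
    rcases lt_or_ge 0 (B v v) with hpos | hneg
    · have : 0 ≤ (‖B‖ + 1) / f v₀ ^ 2 * f v ^ 2 := by positivity
      linarith
    · have h1 : f v₀ ^ 2 ≤ f v ^ 2 := hmin ⟨hv, hneg⟩
      have h2 : ‖B‖ + 1 ≤ (‖B‖ + 1) / f v₀ ^ 2 * f v ^ 2 := by
        rw [div_mul_eq_mul_div, le_div_iff₀ hm]
        gcongr
      have h3 := B.le_opNorm₂ v v
      rw [mem_sphere_zero_iff_norm.1 hv, mul_one, mul_one, Real.norm_eq_abs] at h3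
      have := (abs_le.1 h3).1
      linarith

end Taylor

section Normalization

variable {E : Type*} [NormedAddCommGroup E] [InnerProductSpace ℝ E] [FiniteDimensional ℝ E]

/-- A positive definite quadratic form is the square of the norm in suitable linear coordinates. -/
theorem exists_continuousLinearEquiv_norm_sq (B : LinearMap.BilinForm ℝ E)
    (hsymm : ∀ u v, B u v = B v u) (hpos : ∀ v, v ≠ 0 → 0 < B v v) :
    ∃ T : E ≃L[ℝ] E, ∀ v, B v v = ‖T v‖ ^ 2 := by
  obtain ⟨v, hv⟩ := LinearMap.BilinForm.exists_orthogonal_basis (B := B) ⟨hsymm⟩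
  have hvpos : ∀ i, 0 < B (v i) (v i) := fun i => hpos _ (v.ne_zero i)
  set w := v.isUnitSMul (w := fun i => (√(B (v i) (v i)))⁻¹) (fun i => by
    have := hvpos i
    exact (by positivity : (√(B (v i) (v i)))⁻¹ ≠ 0).isUnit) with hw
  have hww : ∀ i j, B (w i) (w j) = if i = j then 1 else 0 := by
    intro i j
    rw [hw, Module.Basis.isUnitSMul_apply, Module.Basis.isUnitSMul_apply]
    simp only [map_smul, LinearMap.smul_apply, smul_eq_mul]
    split_ifs with hij
    · subst hij
      have := hvpos i
      have h2 := Real.mul_self_sqrt this.le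
      field_simp
      rw [sq, h2]
    · have : B (v i) (v j) = 0 := hv hij
      rw [this]; simp
  set e := stdOrthonormalBasis ℝ E with he
  refine ⟨(w.equiv e.toBasis (Equiv.refl _)).toContinuousLinearEquiv, fun u => ?_⟩
  have h1 : ‖(w.equiv e.toBasis (Equiv.refl _)) u‖ ^ 2 = ∑ i, (w.repr u i) ^ 2 := by
    have h2 : (w.equiv e.toBasis (Equiv.refl _)) u = ∑ i, w.repr u i • e i := by
      conv_lhs => rw [← w.sum_repr u]
      simp only [map_sum, map_smul, Module.Basis.equiv_apply, Equiv.refl_apply,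
        OrthonormalBasis.coe_toBasis]
    rw [← e.sum_sq_norm_inner_right, h2]
    refine Finset.sum_congr rfl fun i _ => ?_
    rw [e.orthonormal.inner_right_fintype, Real.norm_eq_abs, sq_abs]
  change _ = ‖(w.equiv e.toBasis (Equiv.refl _)) u‖ ^ 2
  rw [h1]
  conv_lhs => rw [← w.sum_repr u]
  simp only [map_sum, map_smul, LinearMap.sum_apply, LinearMap.smul_apply, smul_eq_mul, hww]
  simp [sq]

end Normalization

/-! ### Strictly convex points are points of quadratic contact -/

section StrictlyConvex

/-- In suitable linear coordinates, a strictly convex boundary point is a point of quadratic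
contact. The Hessian of the defining function `r` is only positive on the tangent hyperplane; the
coordinates are those of the Hessian of `r + K / 2 * r ^ 2`, which has the same sign as `r`
near `p` and is positive definite for large `K`. -/
theorem IsStrictlyConvexPoint.exists_hasQuadraticContact {d : ℕ}
    {D : Set (EuclideanSpace ℝ (Fin d))} {p : EuclideanSpace ℝ (Fin d)}
    (h : IsStrictlyConvexPoint D p) :
    ∃ (T : EuclideanSpace ℝ (Fin d) ≃L[ℝ] EuclideanSpace ℝ (Fin d))
      (ℓ : EuclideanSpace ℝ (Fin d) → EuclideanSpace ℝ (Fin d) →L[ℝ] ℝ),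
      HasQuadraticContact (T '' D) (T p) ℓ := by
  obtain ⟨hp, U, r, hU, hpU, hr, hess⟩ := h
  have hrp : ContDiffAt ℝ 2 r p := hr.contDiffOn.contDiffAt (hU.mem_nhds hpU)
  have hr0 : ∀ s ∈ frontier D, s ∈ U → r s = 0 := fun s hs hsU => by
    have : s ∈ frontier D ∩ U := ⟨hs, hsU⟩
    rw [hr.frontier_inter_eq] at this
    exact this.2
  have hDr : ∀ x ∈ U, x ∈ D ↔ r x < 0 := fun x hx => by
    have : x ∈ D ∩ U ↔ x ∈ {x ∈ U | r x < 0} := by rw [hr.inter_eq]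
    simpa [hx] using this
  set f := fderiv ℝ r p with hf
  set B := fderiv ℝ (fderiv ℝ r) p with hB
  have hf0 : f ≠ 0 := hr.fderiv_ne_zero p ⟨hp, hpU⟩
  obtain ⟨K, hK, hpos⟩ := exists_add_mul_sq_pos B f hess
  have hsymm : ∀ u v, B u v = B v u := fun u v => (hrp.isSymmSndFDerivAt (by simp)).eq u v
  set Q : LinearMap.BilinForm ℝ (EuclideanSpace ℝ (Fin d)) :=
    LinearMap.mk₂ ℝ (fun u v => 1 / 2 * (B u v + K * (f u * f v)))
      (fun u u' v => by simp; ring) (fun c u v => by simp; ring)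
      (fun u v v' => by simp; ring) (fun c u v => by simp; ring) with hQ
  have hQapp : ∀ u v, Q u v = 1 / 2 * (B u v + K * (f u * f v)) := fun u v => rfl
  obtain ⟨T, hT⟩ := exists_continuousLinearEquiv_norm_sq Q
    (fun u v => by rw [hQapp, hQapp, hsymm u v]; ring)
    (fun v hv => by
      have := hpos v hv
      rw [hQapp, ← sq]
      linarith)
  have hlocal : ∀ ε > 0, ∃ δ > 0, ∀ s ∈ frontier D, dist s p < δ → ∀ x, dist x p < δ →
      (x ∈ D → fderiv ℝ r s (x - s) + (1 - ε) * ‖T (x - s)‖ ^ 2 < 0) ∧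
      (fderiv ℝ r s (x - s) + (1 + ε) * ‖T (x - s)‖ ^ 2 < 0 → x ∈ D) := by
    intro ε hε
    set M := ‖(T.symm : EuclideanSpace ℝ (Fin d) →L[ℝ] EuclideanSpace ℝ (Fin d))‖ with hM
    have hTM : ∀ u, ‖u‖ ^ 2 ≤ M ^ 2 * ‖T u‖ ^ 2 := fun u => by
      have := (T.symm : EuclideanSpace ℝ (Fin d) →L[ℝ] EuclideanSpace ℝ (Fin d)).le_opNorm (T u)
      rw [← mul_pow]
      refine pow_le_pow_left₀ (norm_nonneg _) ?_ 2
      simpa using this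
    set c := (1 + K / 2 * (2 * ‖f‖ + 1)) * (M ^ 2 + 1) with hc
    have hc0 : 0 < c := by positivity
    set ε₁ := min 1 (ε / c) with hε₁
    have hε₁0 : 0 < ε₁ := by positivity
    have hε₁1 : ε₁ ≤ 1 := min_le_left _ _
    have hε₁c : ε₁ * c ≤ ε := by
      rw [← le_div_iff₀ hc0]; exact min_le_right _ _
    obtain ⟨δ₁, hδ₁, htaylor⟩ := exists_taylor_two_of_contDiffAt hrp hε₁0
    have hstrict : HasStrictFDerivAt r f p := hrp.hasStrictFDerivAt (by norm_num)
    obtain ⟨δ₂, hδ₂, hlin⟩ := Metric.eventually_nhds_iff.1 (hstrict.isLittleO.def hε₁0)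
    have hsmall : ∀ᶠ x in 𝓝 p, x ∈ U ∧ 0 < 1 + K / 2 * r x := by
      refine (hU.eventually_mem hpU).and ?_
      have ht : Tendsto (fun x => 1 + K / 2 * r x) (𝓝 p) (𝓝 (1 + K / 2 * r p)) :=
        (hrp.continuousAt.const_mul (K / 2)).const_add 1
      rw [hr0 p hp hpU, mul_zero, add_zero] at ht
      exact ht.eventually (lt_mem_nhds one_pos)
    obtain ⟨δ₃, hδ₃, hsmall⟩ := Metric.eventually_nhds_iff.1 hsmall
    refine ⟨min δ₁ (min δ₂ δ₃), by positivity, fun s hs hsp x hxp => ?_⟩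
    simp only [lt_min_iff] at hsp hxp
    obtain ⟨hxU, hx1⟩ := hsmall hxp.2.2
    have hrs := hr0 s hs (hsmall hsp.2.2).1
    have h1 := htaylor s x hsp.1 hxp.1
    have h2 := hlin (y := (x, s)) (by rw [Prod.dist_eq]; exact max_lt hxp.2.1 hsp.2.1)
    rw [Real.norm_eq_abs] at h2
    simp only [hrs, sub_zero] at h1 h2
    set u := x - s with hu
    have hTu : ‖T u‖ ^ 2 = 1 / 2 * B u u + K / 2 * f u ^ 2 := by
      rw [← hT, hQapp]; ring
    have hfu : |f u| ≤ ‖f‖ * ‖u‖ := f.le_opNorm u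
    have h3 : |r x ^ 2 - f u ^ 2| ≤ ε₁ * (2 * ‖f‖ + 1) * ‖u‖ ^ 2 := by
      have e : r x ^ 2 - f u ^ 2 = (r x - f u) * ((r x - f u) + 2 * f u) := by ring
      rw [e, abs_mul]
      have h4 : |r x - f u + 2 * f u| ≤ (2 * ‖f‖ + 1) * ‖u‖ := by
        refine (abs_add_le _ _).trans ?_
        rw [abs_mul, abs_two]
        have := mul_le_mul_of_nonneg_right hε₁1 (norm_nonneg u)
        linarith
      calc _ ≤ (ε₁ * ‖u‖) * ((2 * ‖f‖ + 1) * ‖u‖) :=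
            mul_le_mul h2 h4 (abs_nonneg _) (by positivity)
        _ = _ := by ring
    have herr : |r x * (1 + K / 2 * r x) - fderiv ℝ r s u - ‖T u‖ ^ 2| ≤ ε * ‖T u‖ ^ 2 := by
      have e : r x * (1 + K / 2 * r x) - fderiv ℝ r s u - ‖T u‖ ^ 2 =
          (r x - fderiv ℝ r s u - 1 / 2 * B u u) + K / 2 * (r x ^ 2 - f u ^ 2) := by
        rw [hTu]; ring
      rw [e]
      refine (abs_add_le _ _).trans ?_
      rw [abs_mul, abs_of_nonneg (by positivity : 0 ≤ K / 2)]
      have h5 := mul_le_mul_of_nonneg_left h3 (by positivity : 0 ≤ K / 2)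
      calc _ ≤ ε₁ * ‖u‖ ^ 2 + K / 2 * (ε₁ * (2 * ‖f‖ + 1) * ‖u‖ ^ 2) := add_le_add h1 h5
        _ = ε₁ * (1 + K / 2 * (2 * ‖f‖ + 1)) * ‖u‖ ^ 2 := by ring
        _ ≤ ε₁ * (1 + K / 2 * (2 * ‖f‖ + 1)) * ((M ^ 2 + 1) * ‖T u‖ ^ 2) := by
          refine mul_le_mul_of_nonneg_left ?_ (by positivity)
          linarith [hTM u, sq_nonneg ‖T u‖]
        _ = ε₁ * c * ‖T u‖ ^ 2 := by rw [hc]; ring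
        _ ≤ _ := mul_le_mul_of_nonneg_right hε₁c (by positivity)
    obtain ⟨h6, h7⟩ := abs_le.1 herr
    rw [hDr x hxU]
    constructor
    · intro hx
      have := mul_neg_of_neg_of_pos hx hx1
      linarith
    · intro hx
      exact neg_of_mul_neg_left (by linarith) hx1.le
  refine ⟨T, fun t => (fderiv ℝ r (T.symm t)).comp (T.symm : _ →L[ℝ] _), ?_, ?_, ?_⟩
  · have hcont : ContinuousAt (fderiv ℝ r) (T.symm (T p)) := by
      rw [T.symm_apply_apply]
      exact (hrp.fderiv_right (m := 1) (by norm_num)).continuousAt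
    have h1 : ContinuousAt (fun t => fderiv ℝ r (T.symm t)) (T p) :=
      ContinuousAt.comp (f := fun t => T.symm t) hcont T.symm.continuous.continuousAt
    exact h1.clm_comp continuousAt_const
  · intro h0
    apply hf0
    ext v
    have := DFunLike.congr_fun h0 (T v)
    simpa using this
  · intro ε hε
    obtain ⟨δ, hδ, hloc⟩ := hlocal ε hε
    obtain ⟨δ', hδ', hδδ⟩ := Metric.continuousAt_iff.1
      (T.symm.continuous.continuousAt (x := T p)) δ hδ
    rw [T.symm_apply_apply] at hδδ
    refine ⟨δ', hδ', fun t ht htp y hyp => ?_⟩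
    have ht' : T.symm t ∈ frontier D := by
      have h1 := T.toHomeomorph.image_frontier D
      have h2 : t ∈ T '' frontier D := by
        rw [show (T '' frontier D) = frontier (T '' D) from h1]; exact ht
      obtain ⟨s, hs, rfl⟩ := h2
      rwa [T.symm_apply_apply]
    have := hloc _ ht' (hδδ htp) _ (hδδ hyp)
    have hmem : T.symm y ∈ D ↔ y ∈ T '' D := by
      constructor
      · intro hy; exact ⟨_, hy, T.apply_symm_apply y⟩
      · rintro ⟨x, hx, rfl⟩; rwa [T.symm_apply_apply]
    rw [hmem, ← map_sub, T.apply_symm_apply] at this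
    exact this

end StrictlyConvex

/-! ### Projective maps in homogeneous coordinates -/

section Projective

variable {d : ℕ}

/-- The identification of `ℝ × ℝ^d` with `ℝ^(d+1)` under which `(1, x)` corresponds to the
homogeneous coordinates of `x`. -/
noncomputable def consEquiv (d : ℕ) : (ℝ × EuclideanSpace ℝ (Fin d)) ≃ₗ[ℝ] (Fin (d + 1) → ℝ) :=
  ((LinearEquiv.refl ℝ ℝ).prodCongr (WithLp.linearEquiv 2 ℝ (Fin d → ℝ))).trans
    (Fin.consLinearEquiv ℝ (fun _ : Fin (d + 1) => ℝ))

theorem consEquiv_one (x : EuclideanSpace ℝ (Fin d)) : consEquiv d (1, x) = homog x := rfl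

/-- A map that is projective on `D` is given by a linear equivalence in homogeneous coordinates. -/
theorem IsProjectiveOn.exists_linearEquiv {D : Set (EuclideanSpace ℝ (Fin d))}
    {f : EuclideanSpace ℝ (Fin d) → EuclideanSpace ℝ (Fin d)} (hf : IsProjectiveOn f D) :
    ∃ Φ : (ℝ × EuclideanSpace ℝ (Fin d)) ≃ₗ[ℝ] (ℝ × EuclideanSpace ℝ (Fin d)),
      ∀ x ∈ D, (Φ (1, x)).1 ≠ 0 ∧ dehomog (Φ (1, x)) = f x := by
  obtain ⟨-, ⟨L, hL, rfl⟩, h⟩ := hf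
  refine ⟨(consEquiv d).trans ((LinearEquiv.ofInjectiveEndo L hL).trans (consEquiv d).symm),
    fun x hx => ?_⟩
  have h1 := h x hx
  rw [affineEmb, affineEmb, Projectivization.map_mk, eq_comm,
    Projectivization.mk_eq_mk_iff'] at h1
  obtain ⟨c, hc⟩ := h1
  have hval : ((consEquiv d).trans ((LinearEquiv.ofInjectiveEndo L hL).trans
      (consEquiv d).symm)) (1, x) = c • (1, f x) := by
    simp only [LinearEquiv.trans_apply]
    rw [LinearEquiv.symm_apply_eq, map_smul, consEquiv_one, consEquiv_one, hc]
    rfl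
  have hc0 : c ≠ 0 := by
    rintro rfl
    rw [zero_smul] at hc
    exact homog_ne_zero x (hL (by rw [← hc, map_zero]))
  rw [hval]
  exact ⟨by simpa using hc0, by simpa using dehomog_mk_smul hc0 (f x)⟩

/-- A projective automorphism of a connected set comes from a linear automorphism of the cone
over it: by connectedness the first coordinate has constant sign on `D`, so it may be taken to be
positive. -/
theorem IsProjectiveAut.exists_linearEquiv {D : Set (EuclideanSpace ℝ (Fin d))}
    (hDc : IsPreconnected D) {f : EuclideanSpace ℝ (Fin d) → EuclideanSpace ℝ (Fin d)}
    (hf : IsProjectiveAut f D) :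
    ∃ Φ : (ℝ × EuclideanSpace ℝ (Fin d)) ≃ₗ[ℝ] (ℝ × EuclideanSpace ℝ (Fin d)),
      (∀ y, Φ y ∈ coneOver D ↔ y ∈ coneOver D) ∧ ∀ x ∈ D, dehomog (Φ (1, x)) = f x := by
  obtain ⟨hproj, hbij⟩ := hf
  obtain ⟨Ψ, hΨ⟩ := hproj.exists_linearEquiv
  suffices h : ∃ Φ : (ℝ × EuclideanSpace ℝ (Fin d)) ≃ₗ[ℝ] (ℝ × EuclideanSpace ℝ (Fin d)),
      ∀ x ∈ D, 0 < (Φ (1, x)).1 ∧ dehomog (Φ (1, x)) = f x by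
    obtain ⟨Φ, hΦ⟩ := h
    refine ⟨Φ, fun y => ⟨fun hy => ?_, fun hy => ?_⟩, fun x hx => (hΦ x hx).2⟩
    · obtain ⟨x, hx, hfx⟩ := hbij.surjOn hy.2
      obtain ⟨h1, h2⟩ := hΦ x hx
      have hy1 : Φ y = (Φ y).1 • ((1 : ℝ), f x) := by
        rw [hfx]; exact eq_smul_dehomog hy.1.ne'
      have hx1 : Φ (1, x) = (Φ (1, x)).1 • ((1 : ℝ), f x) := by
        rw [← h2]; exact eq_smul_dehomog h1.ne'
      have hyx : y = ((Φ y).1 * (Φ (1, x)).1⁻¹) • ((1 : ℝ), x) := by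
        apply Φ.injective
        rw [map_smul]
        nth_rw 2 [hx1]
        rw [smul_smul, inv_mul_cancel_right₀ h1.ne', ← hy1]
      rw [hyx]
      exact (smul_mem_coneOver (mul_pos hy.1 (inv_pos.2 h1))).2 (one_mem_coneOver.2 hx)
    · obtain ⟨h1, h2⟩ := hΦ (dehomog y) hy.2
      rw [eq_smul_dehomog hy.1.ne', map_smul, smul_mem_coneOver hy.1]
      exact mem_coneOver.2 ⟨h1, by rw [h2]; exact hbij.mapsTo hy.2⟩
  have hcont : Continuous fun x : EuclideanSpace ℝ (Fin d) => (Ψ (1, x)).1 := by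
    have : Continuous Ψ := Ψ.toLinearMap.continuous_of_finiteDimensional
    fun_prop
  rcases D.eq_empty_or_nonempty with rfl | ⟨x₀, hx₀⟩
  · exact ⟨Ψ, fun x hx => absurd hx (Set.notMem_empty x)⟩
  have hconn := (hDc.image _ hcont.continuousOn).ordConnected
  have hne : (0 : ℝ) ∉ (fun x => (Ψ (1, x)).1) '' D := by
    rintro ⟨x, hx, h0⟩
    exact (hΨ x hx).1 h0
  rcases lt_or_gt_of_ne (hΨ x₀ hx₀).1 with hneg | hpos
  · refine ⟨Ψ.trans (LinearEquiv.neg ℝ), fun x hx => ?_⟩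
    have hval : (Ψ.trans (LinearEquiv.neg ℝ)) (1, x) = -Ψ (1, x) := rfl
    rw [hval]
    refine ⟨?_, by rw [← (hΨ x hx).2]; simp [dehomog]⟩
    by_contra! hle
    refine hne (hconn.out (Set.mem_image_of_mem _ hx₀) (Set.mem_image_of_mem _ hx) ⟨hneg.le, ?_⟩)
    simpa using hle
  · refine ⟨Ψ, fun x hx => ⟨?_, (hΨ x hx).2⟩⟩
    by_contra! hle
    exact hne (hconn.out (Set.mem_image_of_mem _ hx) (Set.mem_image_of_mem _ hx₀) ⟨hle, hpos.le⟩)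

/-- Sets whose cones are linearly equivalent are projectively equivalent. -/
theorem projectivelyEquivalent_of_coneOver {D D' : Set (EuclideanSpace ℝ (Fin d))}
    (L : (ℝ × EuclideanSpace ℝ (Fin d)) ≃ₗ[ℝ] (ℝ × EuclideanSpace ℝ (Fin d)))
    (hL : ∀ y, L y ∈ coneOver D' ↔ y ∈ coneOver D) : ProjectivelyEquivalent D D' := by
  have hmem : ∀ x ∈ D, L (1, x) ∈ coneOver D' := fun x hx => (hL _).2 (one_mem_coneOver.2 hx)
  refine ⟨fun x => dehomog (L (1, x)), ?_, fun x hx => (hmem x hx).2, ?_, ?_⟩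
  · set M := (consEquiv d).symm.trans (L.trans (consEquiv d)) with hM
    refine ⟨Projectivization.map M.toLinearMap M.injective, ⟨_, M.injective, rfl⟩,
      fun x hx => ?_⟩
    have h1 : (L (1, x)).1 ≠ 0 := (hmem x hx).1.ne'
    rw [affineEmb, affineEmb, Projectivization.map_mk, Projectivization.mk_eq_mk_iff']
    refine ⟨(L (1, x)).1⁻¹, ?_⟩
    have h2 : M (homog x) = consEquiv d (L (1, x)) := by
      rw [hM, ← consEquiv_one]; simp
    change (L (1, x)).1⁻¹ • M (homog x) = _
    rw [h2, ← map_smul, ← consEquiv_one]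
    congr 1
    ext1
    · simp [h1]
    · rfl
  · intro x hx x' hx' h
    have h1 := (hmem x hx).1
    have h2 := (hmem x' hx').1
    have e : L (1, x) = ((L (1, x)).1 * (L (1, x')).1⁻¹) • L (1, x') := by
      have e1 := eq_smul_dehomog h1.ne'
      have e2 : ((1 : ℝ), dehomog (L (1, x'))) = (L (1, x')).1⁻¹ • L (1, x') := by
        rw [eq_inv_smul_iff₀ h2.ne']
        exact (eq_smul_dehomog h2.ne').symm
      rw [show dehomog (L (1, x)) = dehomog (L (1, x')) from h, e2, smul_smul] at e1
      exact e1
    rw [← map_smul] at e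
    have e2 := L.injective e
    have e3 : (1 : ℝ) = (L (1, x)).1 * (L (1, x')).1⁻¹ := by simpa using congrArg Prod.fst e2
    rw [← e3, one_smul] at e2
    exact congrArg Prod.snd e2
  · intro z hz
    have h1 : L.symm (1, z) ∈ coneOver D := by
      rw [← hL, L.apply_symm_apply]; exact one_mem_coneOver.2 hz
    refine ⟨dehomog (L.symm (1, z)), h1.2, ?_⟩
    have h2 := eq_smul_dehomog h1.1.ne'
    have h3 : L (1, dehomog (L.symm (1, z))) = ((L.symm (1, z)).1)⁻¹ • (1, z) := by
      have h4 := congrArg L h2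
      rw [L.apply_symm_apply, map_smul] at h4
      rw [eq_inv_smul_iff₀ h1.1.ne']
      exact h4.symm
    simp only [h3]
    simpa using dehomog_mk_smul (inv_ne_zero h1.1.ne') z

/-- A linear change of the affine coordinates acts on cones. -/
theorem prodCongr_mem_coneOver_image {E : Type*} [NormedAddCommGroup E] [NormedSpace ℝ E]
    (T : E ≃ₗ[ℝ] E) (D : Set E) (y : ℝ × E) :
    ((LinearEquiv.refl ℝ ℝ).prodCongr T) y ∈ coneOver (T '' D) ↔ y ∈ coneOver D := by
  simp [coneOver, ← map_smul]

end Projective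

theorem theorem3 {d : ℕ} (D : Set (EuclideanSpace ℝ (Fin d))) (hDo : IsOpen D)
    (hDc : IsConnected D) (p q : EuclideanSpace ℝ (Fin d)) (hp : p ∈ frontier D) (hq : q ∈ D)
    (φ : ℕ → EuclideanSpace ℝ (Fin d) → EuclideanSpace ℝ (Fin d))
    (hφ : ∀ j, IsProjectiveAut (φ j) D)
    (hlim : Tendsto (fun j => φ j q) atTop (𝓝 p))
    (hsc : IsStrictlyConvexPoint D p) :
    ProjectivelyEquivalent D (Metric.ball (0 : EuclideanSpace ℝ (Fin d)) 1) := by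
  obtain ⟨T, ℓ, hC⟩ := hsc.exists_hasQuadraticContact
  choose Φ hΦ hΦφ using fun j => (hφ j).exists_linearEquiv hDc.isPreconnected
  -- The automorphisms are conjugated by the change of coordinates `T`.
  set S := (LinearEquiv.refl ℝ ℝ).prodCongr T.toLinearEquiv with hS
  have hSmem : ∀ y, S y ∈ coneOver (T '' D) ↔ y ∈ coneOver D :=
    prodCongr_mem_coneOver_image T.toLinearEquiv D
  have hSsymm : ∀ y, S.symm y ∈ coneOver D ↔ y ∈ coneOver (T '' D) := fun y => by
    rw [← hSmem, S.apply_symm_apply]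
  have hTp : T p ∈ frontier (T '' D) := by
    have h1 : T '' frontier D = frontier (T '' D) := T.toHomeomorph.image_frontier D
    rw [← h1]
    exact Set.mem_image_of_mem T hp
  obtain ⟨L, hL⟩ := hC.exists_equiv_coneOver_ball hTp
    (T.toHomeomorph.isOpenMap D hDo)
    (hDc.isPreconnected.image T T.continuous.continuousOn)
    (Φ := fun j => S.symm.trans ((Φ j).trans S))
    (fun j y => by rw [← hSsymm y, ← hΦ j, ← hSmem]; rfl)
    (Set.mem_image_of_mem T hq) (by
      have h1 : ∀ j, dehomog ((S.symm.trans ((Φ j).trans S)) (1, T q)) = T (φ j q) := by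
        intro j
        have h2 : S.symm (1, T q) = (1, q) := by
          rw [LinearEquiv.symm_apply_eq]; rfl
        rw [LinearEquiv.trans_apply, h2, ← hΦφ j q hq]
        simp [hS, dehomog]
      simp only [h1]
      exact (T.continuous.tendsto p).comp hlim)
  exact projectivelyEquivalent_of_coneOver (S.trans L) fun y => by
    rw [LinearEquiv.trans_apply, hL, hSmem]
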